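/- **Theorem (multiparameter stochastic ergodic theorem for nonsingular actions).** Let $(S,\mathcal B,\mu)$ be a standard Borel space with a $\sigma$-finite measure, let $\mathbb T$ be $\mathbb Z$ or $\mathbb R$, and let $\lambda$ be the counting measure on $\mathbb T^d$ if $\mathbb T=\mathbb Z$ and Lebesgue measure if $\mathbb T=\mathbb R$. Let $\{\phi_t\}_{t\in\mathbb T^d}$ be a nonsingular $\mathbb T^d$-action on $(S,\mu)$, that is: $\phi_0=\mathrm{id}$, $\phi_{u+v}=\phi_u\circ\phi_v$, the map $(t,s)\mapsto\phi_t(s)$ is jointly measurable, and $\mu\circ\phi_t^{-1}$ and $\mu$ have the same null sets for every $t$. For $t\in\mathbb T^d$ let $\widehat\phi_t$ be the dual operator on $L^1(S,\mu)$, $$\widehat\phi_t f=\frac{d(\mu\circ\phi_t^{-1})}{d\mu}\; f\circ\phi_t^{-1}.$$ Let $f_0\in L^1(S,\mu)$. Then there exists $\widetilde f\in L^1(S,\mu)$ such that the following holds. 1. Let $w:\mathbb T^d\times S\to\mathbb R$ be any jointly measurable function such that for every $t$, $w(t,s)=\frac{d(\mu\circ\phi_t)}{d\mu}(s)$ for $\mu$-almost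 every $s$ (such a $w$ exists), put $f(t,s)=w(t,s)\,f_0(\phi_t(s))$ (so that $f(t,\cdot)=\widehat\phi_{-t}f_0$ $\mu$-a.e.), and for $T>0$ let $$(A_Tf)(s)=\frac1{(2T)^d}\int_{(-T,T]^d\cap\mathbb T^d}f(t,s)\,\lambda(dt).$$ For every $T>0$ this integral converges absolutely for $\mu$-almost every $s$, and $A_Tf\in L^1(S,\mu)$. As $T\to\infty$, $A_Tf$ converges stochastically (locally in measure) to $\widetilde f$: for all $\varepsilon>0$ and all $B\in\mathcal B$ with $\mu(B)<\infty$, $$\lim_{T\to\infty}\mu\big(\{s:|(A_Tf)(s)-\widetilde f(s)|>\varepsilon\}\cap B\big)=0.$$ 2. $\widetilde f$ is invariant under all dual operators: $\widehat\phi_t\widetilde f=\widetilde f$ $\mu$-a.e. for every $t\in\mathbb T^d$. -/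

import Mathlib

open MeasureTheory Filter Topology

/-- The action of `G` on `(S, μ)` is nonsingular: every translation `s ↦ t +ᵥ s` carries `μ` to a
measure with the same null sets as `μ`. -/
def IsNonsingularAction (G : Type*) {S : Type*} [AddGroup G] [AddAction G S] [MeasurableSpace S]
    (μ : Measure S) : Prop :=
  ∀ t : G, μ.map (fun s => t +ᵥ s) ≪ μ ∧ μ ≪ μ.map (fun s => t +ᵥ s)

/-- The dual operator of an invertible bimeasurable map `e`:
`f ↦ (d(μ ∘ e⁻¹)/dμ) · (f ∘ e⁻¹)`. -/
noncomputable def dualOperator {S : Type*} [MeasurableSpace S] (μ : Measure S) (e : S ≃ᵐ S)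
    (f : S → ℝ) : S → ℝ :=
  fun s => ((μ.map e).rnDeriv μ s).toReal * f (e.symm s)

/-- `w` is a jointly measurable version of the densities `w(t,·) = d(μ ∘ φ_t)/dμ`, where
`φ_t s = t +ᵥ s`; the measure `μ ∘ φ_t : A ↦ μ (φ_t A)` is the image of `μ` under `φ_{-t}`. -/
structure IsDensityVersion {G S : Type*} [AddGroup G] [MeasurableSpace G] [AddAction G S]
    [MeasurableSpace S] (μ : Measure S) (w : G → S → ℝ) : Prop where
  measurable : Measurable (fun p : G × S => w p.1 p.2)
  ae_eq : ∀ t : G, w t =ᵐ[μ] fun s => ((μ.map (fun x => -t +ᵥ x)).rnDeriv μ s).toReal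

/-- The cube `B(T) = (-T, T]^d ∩ ℤ^d`. -/
def cubeInt (d : ℕ) (T : ℝ) : Set (Fin d → ℤ) := {t | ∀ i, -T < (t i : ℝ) ∧ (t i : ℝ) ≤ T}

/-- The cube `B(T) = (-T, T]^d` in `ℝ^d`. -/
def cubeReal (d : ℕ) (T : ℝ) : Set (Fin d → ℝ) := {t | ∀ i, -T < t i ∧ t i ≤ T}

/-- The average `A_T h = (2T)^{-d} ∑_{t ∈ B(T)} h(t)` of `h : ℤ^d → ℝ`, written as an integral
with respect to the counting measure. -/
noncomputable def averageInt {d : ℕ} (T : ℝ) (h : (Fin d → ℤ) → ℝ) : ℝ :=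
  1 / (2 * T) ^ d * ∫ t in cubeInt d T, h t ∂Measure.count

/-- The average `A_T h = (2T)^{-d} ∫_{B(T)} h(t) dt` of `h : ℝ^d → ℝ`. -/
noncomputable def averageReal {d : ℕ} (T : ℝ) (h : (Fin d → ℝ) → ℝ) : ℝ :=
  1 / (2 * T) ^ d * ∫ t in cubeReal d T, h t

/-- Stochastic convergence (local convergence in measure) of `F T` to `g` as `T → ∞`. -/
def ConvergesStochastically {S : Type*} [MeasurableSpace S] (μ : Measure S) (F : ℝ → S → ℝ)
    (g : S → ℝ) : Prop :=
  ∀ ε : ℝ, 0 < ε → ∀ B : Set S, MeasurableSet B → μ B < ⊤ →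
    Tendsto (fun T : ℝ => μ ({s | ε < |F T s - g s|} ∩ B)) atTop (𝓝 0)

/-- For a nonsingular action on a standard Borel space with a `σ`-finite measure, jointly
measurable versions of the densities exist. -/
theorem exists_isDensityVersion {G S : Type*} [AddGroup G] [MeasurableSpace G]
    [MeasurableNeg G] [AddAction G S] [MeasurableSpace S] [StandardBorelSpace S]
    [MeasurableVAdd₂ G S] (μ : Measure S) [SigmaFinite μ] (hφ : IsNonsingularAction G μ) :
    ∃ w : G → S → ℝ, IsDensityVersion μ w := by
  let p : Measure S := μ.toFinite
  have hpμ : p ≪ μ := toFinite_absolutelyContinuous μ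
  have hμp : μ ≪ p := absolutelyContinuous_toFinite μ
  have hψ : Measurable (fun q : G × S => -q.1 +ᵥ q.2) := measurable_fst.neg.vadd measurable_snd
  let κ : ProbabilityTheory.Kernel G S :=
    (ProbabilityTheory.Kernel.prod ProbabilityTheory.Kernel.id
      (ProbabilityTheory.Kernel.const G p)).map
      (fun q : G × S => -q.1 +ᵥ q.2)
  let η : ProbabilityTheory.Kernel G S := ProbabilityTheory.Kernel.const G p
  have hκ : ∀ t, κ t = p.map (fun x => -t +ᵥ x) := by
    intro t
    simp only [κ]
    rw [ProbabilityTheory.Kernel.map_apply _ hψ, ProbabilityTheory.Kernel.prod_apply,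
      ProbabilityTheory.Kernel.id_apply, ProbabilityTheory.Kernel.const_apply, Measure.dirac_prod,
      Measure.map_map hψ (by fun_prop)]
    rfl
  have : ProbabilityTheory.IsFiniteKernel κ := by
    simp only [κ]; infer_instance
  let r : G → S → ENNReal := fun t s => ProbabilityTheory.Kernel.rnDeriv κ η t s
  let W : G → S → ENNReal := fun t s => p.rnDeriv μ s * (r t s * μ.rnDeriv p (t +ᵥ s))
  have hk : Measurable (μ.rnDeriv p) := Measure.measurable_rnDeriv _ _
  have hl : Measurable (p.rnDeriv μ) := Measure.measurable_rnDeriv _ _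
  have hr : Measurable (fun q : G × S => r q.1 q.2) :=
    ProbabilityTheory.Kernel.measurable_rnDeriv κ η
  refine ⟨fun t s => (W t s).toReal, ?_, ?_⟩
  · exact ((hl.comp measurable_snd).mul
      (hr.mul (hk.comp (measurable_fst.vadd measurable_snd)))).ennreal_toReal
  · intro t
    have hm : Measurable (fun x : S => -t +ᵥ x) := measurable_const_vadd _
    have hrt : Measurable (r t) := hr.comp measurable_prodMk_left
    have hkt : Measurable (fun s : S => μ.rnDeriv p (t +ᵥ s)) :=
      hk.comp (measurable_const_vadd t)
    have hac : p.map (fun x => -t +ᵥ x) ≪ p :=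
      ((hpμ.map hm).trans (hφ (-t)).1).trans hμp
    have h1 : p.withDensity (r t) = p.map (fun x => -t +ᵥ x) := by
      have h : r t =ᵐ[p] (p.map (fun x => -t +ᵥ x)).rnDeriv p := by
        have := ProbabilityTheory.Kernel.rnDeriv_eq_rnDeriv_measure (κ := κ) (η := η) (a := t)
        rw [hκ t] at this
        exact this
      rw [withDensity_congr_ae h, Measure.withDensity_rnDeriv_eq _ _ hac]
    have h2 : μ.map (fun x => -t +ᵥ x)
        = (p.map (fun x => -t +ᵥ x)).withDensity (fun s => μ.rnDeriv p (t +ᵥ s)) := by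
      ext A hA
      rw [Measure.map_apply hm hA, withDensity_apply _ hA, setLIntegral_map hA hkt hm]
      simp only [vadd_neg_vadd]
      rw [← withDensity_apply _ (hm hA), Measure.withDensity_rnDeriv_eq _ _ hμp]
    have h3 : μ.map (fun x => -t +ᵥ x) = μ.withDensity (W t) := by
      rw [h2, ← h1, ← withDensity_mul _ hrt hkt]
      have h5 : ∀ g : S → ENNReal, Measurable g →
          p.withDensity g = μ.withDensity (p.rnDeriv μ * g) := by
        intro g hg
        rw [withDensity_mul _ hl hg, Measure.withDensity_rnDeriv_eq _ _ hpμ]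
      exact h5 _ (hrt.mul hkt)
    have hW : Measurable (W t) := hl.mul (hrt.mul hkt)
    have h4 := Measure.rnDeriv_withDensity μ hW
    rw [← h3] at h4
    filter_upwards [h4] with s hs
    rw [hs]

open Measure
open scoped ENNReal NNReal

/-! The group acts by U_t f = w_t · f∘φ_t, isometrically on L¹, and by V_t g = √w_t · g∘φ_t,
isometrically on L²; moreover U_t(ug) = V_t u · V_t g (`translateL1_mulL2`). L² splits orthogonally
into the closed span of the coboundaries V_r y − y and the V-invariant vectors
(`mem_orthogonal_coboundaryClosure`).

Let u be V-invariant. Splitting g accordingly shows that the averages of ug converge in L¹, since ug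
is then a U-coboundary or U-invariant. By approximation the averages converge for every f supported
on {u ≠ 0} (`mem_convergenceSubmodule_of_support`).

Let u be the invariant component of a strictly positive v ∈ L², and N = {u = 0}. Then v·1_N lies in
the coboundary closure (`exists_invariant_indicator_mem`). For f supported on N the functions √|A_T
f| are bounded in L² and asymptotically V-invariant, hence asymptotically orthogonal to v·1_N; as v
> 0, A_T f → 0 locally in measure on N. Off N it vanishes, because N is invariant up to null sets.
So the limit comes from {u ≠ 0} alone. Of the cubes only the Følner property is used, which treats
ℤ^d and ℝ^d together. -/

/-- A nonnegative jointly measurable density cocycle of a nonsingular action, characterized by the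
change of variables formula. -/
structure IsDensityCocycle {G S : Type*} [AddGroup G] [MeasurableSpace G] [AddAction G S]
    [MeasurableSpace S] (μ : Measure S) (w : G → S → ℝ) : Prop where
  measurable : Measurable (fun p : G × S => w p.1 p.2)
  nonneg : ∀ t s, 0 ≤ w t s
  quasi : ∀ t : G, QuasiMeasurePreserving (fun s : S => t +ᵥ s) μ μ
  lintegral : ∀ (t : G) (F : S → ℝ≥0∞), Measurable F →
    ∫⁻ s, ENNReal.ofReal (w t s) * F (t +ᵥ s) ∂μ = ∫⁻ s, F s ∂μ

/-! ### Density cocycles and their almost everywhere identities -/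

section Cocycle

set_option linter.unusedSectionVars false

variable {G S : Type*} [AddCommGroup G] [MeasurableSpace G] [AddAction G S]
  [MeasurableSpace S] [MeasurableVAdd₂ G S] {μ : Measure S} [SigmaFinite μ] {w : G → S → ℝ}

/-- A version may be negative on null sets; the absolute value makes √w_t meaningful everywhere
without changing any w_t modulo μ. -/
theorem IsDensityVersion.isDensityCocycle_abs (hφ : IsNonsingularAction G μ)
    (hw : IsDensityVersion μ w) : IsDensityCocycle μ (fun t s => |w t s|) where
  measurable := hw.measurable.abs
  nonneg t s := abs_nonneg _
  quasi t := ⟨measurable_const_vadd t, (hφ t).1⟩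
  lintegral t F hF := by
    have hm : Measurable (fun s : S => t +ᵥ s) := measurable_const_vadd t
    have hm' : Measurable (fun s : S => -t +ᵥ s) := measurable_const_vadd (-t)
    have : SigmaFinite (μ.map (fun s : S => -t +ᵥ s)) :=
      (MeasurableEquiv.vadd (-t) : S ≃ᵐ S).sigmaFinite_map
    have h1 : ∀ᵐ s ∂μ, ENNReal.ofReal |w t s| * F (t +ᵥ s)
        = (μ.map (fun x => -t +ᵥ x)).rnDeriv μ s * F (t +ᵥ s) := by
      filter_upwards [hw.ae_eq t, Measure.rnDeriv_lt_top (μ.map (fun x => -t +ᵥ x)) μ]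
        with s hs hs'
      rw [hs, abs_of_nonneg ENNReal.toReal_nonneg, ENNReal.ofReal_toReal hs'.ne]
    rw [lintegral_congr_ae h1,
      lintegral_rnDeriv_mul (f := fun s => F (t +ᵥ s)) (hφ (-t)).1 (hF.comp hm).aemeasurable,
      lintegral_map (f := fun s => F (t +ᵥ s)) (hF.comp hm) hm']
    simp

theorem IsDensityVersion.ae_eq_of_version {w' : G → S → ℝ} (hw : IsDensityVersion μ w)
    (hw' : IsDensityVersion μ w') (t : G) : ∀ᵐ s ∂μ, w t s = |w' t s| := by
  filter_upwards [hw.ae_eq t, hw'.ae_eq t] with s h h'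
  rw [h, h', abs_of_nonneg ENNReal.toReal_nonneg]

namespace IsDensityCocycle

variable (hw : IsDensityCocycle μ w)
include hw

theorem measurable_apply (t : G) : Measurable (w t) := hw.measurable.comp measurable_prodMk_left

/-- Testing the change of variables on the image φ_t Z of the zero set Z of w_t shows that φ_t Z is
null, and nonsingularity pulls this back to Z. -/
theorem pos_ae (t : G) : ∀ᵐ s ∂μ, 0 < w t s := by
  have hZ : MeasurableSet {s | w t s = 0} :=
    hw.measurable_apply t (measurableSet_singleton 0)
  have hm' : Measurable (fun s : S => -t +ᵥ s) := measurable_const_vadd (-t)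
  have hZ' : MeasurableSet ((fun s : S => -t +ᵥ s) ⁻¹' {s | w t s = 0}) := hm' hZ
  have h := hw.lintegral t (((fun s : S => -t +ᵥ s) ⁻¹' {s | w t s = 0}).indicator 1)
    (measurable_one.indicator hZ')
  rw [lintegral_indicator_one hZ', lintegral_eq_zero_of_ae_eq_zero] at h
  · have h2 := (hw.quasi t).preimage_null h.symm
    rw [← Set.preimage_comp] at h2
    have h3 : ((fun s : S => -t +ᵥ s) ∘ fun s : S => t +ᵥ s) = id := by
      ext s; simp
    rw [h3, Set.preimage_id] at h2
    have : ∀ᵐ s ∂μ, ¬ w t s = 0 := by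
      rw [ae_iff]; simpa using h2
    filter_upwards [this] with s hs
    exact lt_of_le_of_ne (hw.nonneg t s) (Ne.symm hs)
  · refine Eventually.of_forall fun s => ?_
    by_cases hs : w t s = 0 <;> simp [hs]

/-- Both sides have the same integral over every A: change variables with the test function
1_A∘φ_{-(t+r)}, twice on the left and once on the right. The null set depends on t and r, so later
uses go through Fubini. -/
theorem cocycle (t r : G) : ∀ᵐ s ∂μ, w t s * w r (t +ᵥ s) = w (t + r) s := by
  have hm : Measurable (fun s : S => t +ᵥ s) := measurable_const_vadd t
  have hmtr : Measurable (fun s : S => -(t + r) +ᵥ s) := measurable_const_vadd _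
  have h1 := (hw.measurable_apply t).ennreal_ofReal
  have h2 := (hw.measurable_apply r).ennreal_ofReal
  have h3 := (hw.measurable_apply (t + r)).ennreal_ofReal
  have : (fun s => ENNReal.ofReal (w t s) * ENNReal.ofReal (w r (t +ᵥ s))) =ᵐ[μ]
      fun s => ENNReal.ofReal (w (t + r) s) := by
    refine ae_eq_of_forall_setLIntegral_eq_of_sigmaFinite (h1.mul (h2.comp hm)) h3 ?_
    intro A hA _
    let χ : S → ℝ≥0∞ := A.indicator 1
    have hχ : Measurable χ := measurable_one.indicator hA
    rw [← lintegral_indicator hA, ← lintegral_indicator hA]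
    have e1 : ∀ s, A.indicator (fun s => ENNReal.ofReal (w t s) * ENNReal.ofReal (w r (t +ᵥ s))) s
        = ENNReal.ofReal (w t s) * (fun x => ENNReal.ofReal (w r x) *
          (fun y => χ (-(t + r) +ᵥ y)) (r +ᵥ x)) (t +ᵥ s) := by
      intro s
      have : -(t + r) +ᵥ (r +ᵥ (t +ᵥ s)) = s := by
        rw [vadd_vadd, vadd_vadd]; simp [add_comm]
      simp only [this, χ]
      by_cases hs : s ∈ A <;> simp [hs]
    have e2 : ∀ s, A.indicator (fun s => ENNReal.ofReal (w (t + r) s)) s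
        = ENNReal.ofReal (w (t + r) s) * (fun y => χ (-(t + r) +ᵥ y)) ((t + r) +ᵥ s) := by
      intro s
      simp only [neg_vadd_vadd, χ]
      by_cases hs : s ∈ A <;> simp [hs]
    have hχ' : Measurable fun y => χ (-(t + r) +ᵥ y) := hχ.comp hmtr
    rw [lintegral_congr e1, lintegral_congr e2,
      hw.lintegral t (fun x => ENNReal.ofReal (w r x) * (fun y => χ (-(t + r) +ᵥ y)) (r +ᵥ x))
        (h2.mul (hχ'.comp (measurable_const_vadd r))),
      hw.lintegral (t + r) _ hχ']
    exact hw.lintegral r _ hχ'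
  filter_upwards [this] with s hs
  rw [← ENNReal.ofReal_mul (hw.nonneg _ _)] at hs
  exact (ENNReal.ofReal_eq_ofReal_iff (mul_nonneg (hw.nonneg _ _) (hw.nonneg _ _))
    (hw.nonneg _ _)).1 hs

theorem ae_vadd {P : S → Prop} (h : ∀ᵐ s ∂μ, P s) (t : G) : ∀ᵐ s ∂μ, P (t +ᵥ s) :=
  (hw.quasi t).ae h

theorem ae_ae_vadd {P : S → Prop} (h : ∀ᵐ s ∂μ, P s) (lam : Measure G) [SFinite lam] :
    ∀ᵐ s ∂μ, ∀ᵐ t ∂lam, P (t +ᵥ s) := by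
  -- Exchanging the quantifiers needs a measurable set, and P need not define one.
  obtain ⟨Z, hZ, hZm, hZ0⟩ := exists_measurable_superset_of_null (ae_iff.1 h)
  have key : ∀ᵐ s ∂μ, ∀ᵐ t ∂lam, t +ᵥ s ∉ Z := by
    rw [ae_ae_comm]
    · refine Eventually.of_forall fun t => hw.ae_vadd (P := fun s => s ∉ Z) ?_ t
      rw [ae_iff]; simpa using hZ0
    · exact (measurable_snd.vadd measurable_fst) hZm.compl
  filter_upwards [key] with s hs
  filter_upwards [hs] with t ht
  by_contra hc
  exact ht (hZ hc)

end IsDensityCocycle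
end Cocycle

/-! ### Translation operators on L¹ and L² -/

/-- The bounded operator on `Lp` given by a bounded map on functions that is linear almost
everywhere. -/
noncomputable def lpOperator {S : Type*} [MeasurableSpace S] {μ : Measure S} {p : ℝ≥0∞}
    [Fact (1 ≤ p)] (Φ : Lp ℝ p μ → S → ℝ) (hmem : ∀ F, MemLp (Φ F) p μ)
    (hadd : ∀ F H, Φ (F + H) =ᵐ[μ] fun s => Φ F s + Φ H s)
    (hsmul : ∀ (a : ℝ) F, Φ (a • F) =ᵐ[μ] fun s => a * Φ F s) (C : ℝ)
    (hC : ∀ F, ‖(hmem F).toLp‖ ≤ C * ‖F‖) : Lp ℝ p μ →L[ℝ] Lp ℝ p μ :=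
  LinearMap.mkContinuous
    { toFun := fun F => (hmem F).toLp
      map_add' := fun F H => by
        rw [← MemLp.toLp_add]
        exact MemLp.toLp_congr _ _ (hadd F H)
      map_smul' := fun a F => by
        rw [RingHom.id_apply, ← MemLp.toLp_const_smul]
        exact MemLp.toLp_congr _ _ (hsmul a F) } C hC

theorem norm_lpOperator_apply_le {S : Type*} [MeasurableSpace S] {μ : Measure S} {p : ℝ≥0∞}
    [Fact (1 ≤ p)] (Φ : Lp ℝ p μ → S → ℝ) (hmem : ∀ F, MemLp (Φ F) p μ)
    (hadd : ∀ F H, Φ (F + H) =ᵐ[μ] fun s => Φ F s + Φ H s)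
    (hsmul : ∀ (a : ℝ) F, Φ (a • F) =ᵐ[μ] fun s => a * Φ F s) (C : ℝ)
    (hC : ∀ F, ‖(hmem F).toLp‖ ≤ C * ‖F‖) (F : Lp ℝ p μ) :
    ‖lpOperator Φ hmem hadd hsmul C hC F‖ ≤ C * ‖F‖ :=
  hC F

namespace IsDensityCocycle

set_option linter.unusedSectionVars false

variable {G S : Type*} [AddCommGroup G] [MeasurableSpace G] [AddAction G S]
  [MeasurableSpace S] [MeasurableVAdd₂ G S] {μ : Measure S} [SigmaFinite μ] {w : G → S → ℝ}

section Translation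

variable (hw : IsDensityCocycle μ w)
include hw

theorem lintegral_enorm_translate (t : G) {f : S → ℝ} (hf : Measurable f) :
    ∫⁻ s, ‖w t s * f (t +ᵥ s)‖ₑ ∂μ = ∫⁻ s, ‖f s‖ₑ ∂μ := by
  rw [← hw.lintegral t _ hf.enorm]
  refine lintegral_congr fun s => ?_
  rw [enorm_mul, Real.enorm_of_nonneg (hw.nonneg t s)]

theorem eLpNorm_two_translate (t : G) {f : S → ℝ} (hf : Measurable f) :
    eLpNorm (fun s => √(w t s) * f (t +ᵥ s)) 2 μ = eLpNorm f 2 μ := by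
  rw [eLpNorm_eq_lintegral_rpow_enorm_toReal (by simp) (by simp),
    eLpNorm_eq_lintegral_rpow_enorm_toReal (by simp) (by simp)]
  congr 1
  rw [← hw.lintegral t _ (hf.enorm.pow_const _)]
  refine lintegral_congr fun s => ?_
  rw [enorm_mul, ENNReal.mul_rpow_of_nonneg _ _ (by simp), Real.enorm_of_nonneg (Real.sqrt_nonneg _),
    ENNReal.ofReal_rpow_of_nonneg (Real.sqrt_nonneg _) (by simp)]
  congr 2
  simp [Real.sq_sqrt (hw.nonneg t s)]

theorem memLp_one_translate (t : G) (F : Lp ℝ 1 μ) :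
    MemLp (fun s => w t s * F (t +ᵥ s)) 1 μ := by
  have hF := (Lp.stronglyMeasurable F).measurable
  refine ⟨((hw.measurable_apply t).mul
    (hF.comp (measurable_const_vadd t))).aestronglyMeasurable, ?_⟩
  rw [eLpNorm_one_eq_lintegral_enorm, hw.lintegral_enorm_translate t hF,
    ← eLpNorm_one_eq_lintegral_enorm]
  exact Lp.eLpNorm_lt_top F

theorem memLp_two_translate (t : G) (F : Lp ℝ 2 μ) :
    MemLp (fun s => √(w t s) * F (t +ᵥ s)) 2 μ := by
  have hF := (Lp.stronglyMeasurable F).measurable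
  refine ⟨((hw.measurable_apply t).sqrt.mul
    (hF.comp (measurable_const_vadd t))).aestronglyMeasurable, ?_⟩
  rw [hw.eLpNorm_two_translate t hF]
  exact Lp.eLpNorm_lt_top F

/-- The translation `f ↦ w_t · f ∘ φ_t` on `L¹`. -/
noncomputable def translateL1 (t : G) : Lp ℝ 1 μ →L[ℝ] Lp ℝ 1 μ :=
  lpOperator (fun F s => w t s * F (t +ᵥ s)) (hw.memLp_one_translate t)
    (fun F H => by
      filter_upwards [hw.ae_vadd (Lp.coeFn_add F H) t] with s hs
      rw [hs, Pi.add_apply, mul_add])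
    (fun a F => by
      filter_upwards [hw.ae_vadd (Lp.coeFn_smul a F) t] with s hs
      rw [hs, Pi.smul_apply, smul_eq_mul, mul_left_comm]) 1
    (fun F => by
      rw [one_mul, Lp.norm_toLp, Lp.norm_def, eLpNorm_one_eq_lintegral_enorm,
        eLpNorm_one_eq_lintegral_enorm,
        hw.lintegral_enorm_translate t (Lp.stronglyMeasurable F).measurable])

theorem coeFn_translateL1 (t : G) (F : Lp ℝ 1 μ) :
    hw.translateL1 t F =ᵐ[μ] fun s => w t s * F (t +ᵥ s) :=
  (hw.memLp_one_translate t F).coeFn_toLp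

/-- The translation `g ↦ √w_t · g ∘ φ_t` on `L²`. -/
noncomputable def translateL2 (t : G) : Lp ℝ 2 μ →L[ℝ] Lp ℝ 2 μ :=
  lpOperator (fun F s => √(w t s) * F (t +ᵥ s)) (hw.memLp_two_translate t)
    (fun F H => by
      filter_upwards [hw.ae_vadd (Lp.coeFn_add F H) t] with s hs
      rw [hs, Pi.add_apply, mul_add])
    (fun a F => by
      filter_upwards [hw.ae_vadd (Lp.coeFn_smul a F) t] with s hs
      rw [hs, Pi.smul_apply, smul_eq_mul, mul_left_comm]) 1
    (fun F => by
      rw [one_mul, Lp.norm_toLp, Lp.norm_def,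
        hw.eLpNorm_two_translate t (Lp.stronglyMeasurable F).measurable])

theorem coeFn_translateL2 (t : G) (F : Lp ℝ 2 μ) :
    hw.translateL2 t F =ᵐ[μ] fun s => √(w t s) * F (t +ᵥ s) :=
  (hw.memLp_two_translate t F).coeFn_toLp

theorem norm_translateL2 (t : G) (F : Lp ℝ 2 μ) : ‖hw.translateL2 t F‖ = ‖F‖ := by
  change ‖(hw.memLp_two_translate t F).toLp‖ = _
  rw [Lp.norm_toLp, Lp.norm_def,
        hw.eLpNorm_two_translate t (Lp.stronglyMeasurable F).measurable]

theorem inner_translateL2 (t : G) (F H : Lp ℝ 2 μ) :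
    inner ℝ (hw.translateL2 t F) (hw.translateL2 t H) = inner ℝ F H :=
  LinearIsometry.inner_map_map ⟨(hw.translateL2 t).toLinearMap, hw.norm_translateL2 t⟩ F H

end Translation

/-! ### Weighted averaging operators on L¹ -/

/-- The average `s ↦ ∫ ρ(t) w(t,s) f(φ_t s) λ(dt)`. -/
noncomputable def _root_.weightedAverage (lam : Measure G) (w : G → S → ℝ) (ρ : G → ℝ)
    (f : S → ℝ) (s : S) : ℝ :=
  ∫ t, ρ t * (w t s * f (t +ᵥ s)) ∂lam

section Average

variable {lam : Measure G} [SFinite lam] {ρ ρ' : G → ℝ} (hw : IsDensityCocycle μ w)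
include hw

theorem aestronglyMeasurable_average_kernel (hρ : AEStronglyMeasurable ρ lam) {f : S → ℝ}
    (hfm : Measurable f) :
    AEStronglyMeasurable (fun p : S × G => ρ p.2 * (w p.2 p.1 * f (p.2 +ᵥ p.1)))
      (μ.prod lam) :=
  hρ.comp_snd.mul ((hw.measurable.comp measurable_swap).mul
    (hfm.comp (measurable_snd.vadd measurable_fst))).aestronglyMeasurable

/-- Tonelli and the L¹-isometry of each translation; this gives both the integrability of the kernel
and the operator bound by ∫|ρ|. -/
theorem lintegral_average_kernel (hρ : AEStronglyMeasurable ρ lam) {f : S → ℝ}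
    (hfm : Measurable f) :
    ∫⁻ p : S × G, ‖ρ p.2 * (w p.2 p.1 * f (p.2 +ᵥ p.1))‖ₑ ∂μ.prod lam
      = (∫⁻ t, ‖ρ t‖ₑ ∂lam) * ∫⁻ s, ‖f s‖ₑ ∂μ := by
  rw [lintegral_prod_symm _ (hw.aestronglyMeasurable_average_kernel hρ hfm).enorm,
    ← lintegral_mul_const'' _ hρ.enorm]
  refine lintegral_congr fun t => ?_
  simp only [enorm_mul (ρ t)]
  rw [lintegral_const_mul (f := fun s => ‖w t s * f (t +ᵥ s)‖ₑ) _ ((hw.measurable_apply t).mul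
    (hfm.comp (measurable_const_vadd t))).enorm, hw.lintegral_enorm_translate t hfm]

theorem integrable_average_kernel (hρ : Integrable ρ lam) {f : S → ℝ} (hfm : Measurable f)
    (hf : Integrable f μ) :
    Integrable (fun p : S × G => ρ p.2 * (w p.2 p.1 * f (p.2 +ᵥ p.1))) (μ.prod lam) := by
  refine ⟨hw.aestronglyMeasurable_average_kernel hρ.1 hfm, ?_⟩
  rw [hasFiniteIntegral_iff_enorm, hw.lintegral_average_kernel hρ.1 hfm]
  exact ENNReal.mul_lt_top hρ.2 hf.2

theorem ae_integrable_average_kernel (hρ : Integrable ρ lam) (F : Lp ℝ 1 μ) :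
    ∀ᵐ s ∂μ, Integrable (fun t => ρ t * (w t s * F (t +ᵥ s))) lam :=
  (hw.integrable_average_kernel hρ (Lp.stronglyMeasurable F).measurable
    (L1.integrable_coeFn F)).prod_right_ae

theorem memLp_average (hρ : Integrable ρ lam) (F : Lp ℝ 1 μ) :
    MemLp (weightedAverage lam w ρ F) 1 μ :=
  memLp_one_iff_integrable.2 (hw.integrable_average_kernel hρ (Lp.stronglyMeasurable F).measurable
    (L1.integrable_coeFn F)).integral_prod_left

theorem average_congr {f f' : S → ℝ} (h : f =ᵐ[μ] f') :
    weightedAverage lam w ρ f =ᵐ[μ] weightedAverage lam w ρ f' := by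
  filter_upwards [hw.ae_ae_vadd h lam] with s hs
  refine integral_congr_ae ?_
  filter_upwards [hs] with t ht
  rw [ht]

/-- The averaging operator on `L¹` with weight `ρ`. -/
noncomputable def averageL1 (hρ : Integrable ρ lam) : Lp ℝ 1 μ →L[ℝ] Lp ℝ 1 μ :=
  lpOperator (fun F => weightedAverage lam w ρ F) (hw.memLp_average hρ)
    (fun F H => by
      filter_upwards [hw.average_congr (lam := lam) (ρ := ρ) (Lp.coeFn_add F H),
        hw.ae_integrable_average_kernel hρ F, hw.ae_integrable_average_kernel hρ H]
        with s hs hF hH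
      rw [hs]
      simp only [weightedAverage]
      rw [← integral_add hF hH]
      simp only [Pi.add_apply, mul_add])
    (fun a F => by
      filter_upwards [hw.average_congr (lam := lam) (ρ := ρ) (Lp.coeFn_smul a F)] with s hs
      rw [hs]
      simp only [weightedAverage]
      rw [← integral_const_mul]
      refine integral_congr_ae (Eventually.of_forall fun t => ?_)
      simp only [Pi.smul_apply, smul_eq_mul]
      ring) (∫ t, ‖ρ t‖ ∂lam)
    (fun F => by
      have hFm := (Lp.stronglyMeasurable F).measurable
      have hk := hw.integrable_average_kernel hρ hFm (L1.integrable_coeFn F)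
      rw [Lp.norm_toLp, Lp.norm_def, eLpNorm_one_eq_lintegral_enorm,
        eLpNorm_one_eq_lintegral_enorm, integral_norm_eq_lintegral_enorm hρ.1,
        ← ENNReal.toReal_mul, ← hw.lintegral_average_kernel hρ.1 hFm]
      refine ENNReal.toReal_mono hk.2.ne ?_
      rw [lintegral_prod _ hk.1.enorm]
      exact lintegral_mono fun s => enorm_integral_le_lintegral_enorm _)

theorem coeFn_averageL1 (hρ : Integrable ρ lam) (F : Lp ℝ 1 μ) :
    hw.averageL1 hρ F =ᵐ[μ] weightedAverage lam w ρ F :=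
  (hw.memLp_average hρ F).coeFn_toLp

theorem norm_averageL1_le (hρ : Integrable ρ lam) (F : Lp ℝ 1 μ) :
    ‖hw.averageL1 hρ F‖ ≤ (∫ t, ‖ρ t‖ ∂lam) * ‖F‖ :=
  norm_lpOperator_apply_le ..

theorem averageL1_sub (hρ : Integrable ρ lam) (hρ' : Integrable ρ' lam) (F : Lp ℝ 1 μ) :
    hw.averageL1 hρ F - hw.averageL1 hρ' F = hw.averageL1 (hρ.sub hρ') F := by
  refine Lp.ext ?_
  filter_upwards [Lp.coeFn_sub (hw.averageL1 hρ F) (hw.averageL1 hρ' F),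
    hw.coeFn_averageL1 hρ F, hw.coeFn_averageL1 hρ' F, hw.coeFn_averageL1 (hρ.sub hρ') F,
    hw.ae_integrable_average_kernel hρ F, hw.ae_integrable_average_kernel hρ' F]
    with s h1 h2 h3 h4 h5 h6
  rw [h1, Pi.sub_apply, h2, h3, h4]
  simp only [weightedAverage]
  rw [← integral_sub h5 h6]
  simp only [Pi.sub_apply, sub_mul]

theorem averageL1_of_invariant (hρ : Integrable ρ lam) {F : Lp ℝ 1 μ}
    (hF : ∀ t, hw.translateL1 t F = F) : hw.averageL1 hρ F = (∫ t, ρ t ∂lam) • F := by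
  have hFm := (Lp.stronglyMeasurable F).measurable
  have key : ∀ᵐ s ∂μ, ∀ᵐ t ∂lam, w t s * F (t +ᵥ s) = F s := by
    rw [ae_ae_comm]
    · refine Eventually.of_forall fun t => ?_
      have := hw.coeFn_translateL1 t F
      rw [hF t] at this
      filter_upwards [this] with s hs using hs.symm
    · exact measurableSet_eq_fun ((hw.measurable.comp measurable_swap).mul
        (hFm.comp (measurable_snd.vadd measurable_fst))) (hFm.comp measurable_fst)
  refine Lp.ext ?_
  filter_upwards [hw.coeFn_averageL1 hρ F, Lp.coeFn_smul (∫ t, ρ t ∂lam) F, key] with s h1 h2 h3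
  rw [h1, h2, Pi.smul_apply, smul_eq_mul, ← integral_mul_const]
  refine integral_congr_ae ?_
  filter_upwards [h3] with t ht
  rw [ht]

variable [MeasurableAdd₂ G] [lam.IsAddLeftInvariant]

/-- The cocycle identity and invariance of `lam` move a translation of the average onto the weight.
Together with `averageL1_translateL1`, where the translation is applied first, this reduces
coboundary estimates to the L¹ size of ρ(· − r) − ρ. -/
theorem average_shift (r : G) (f : S → ℝ) :
    ∀ᵐ s ∂μ, w r s * weightedAverage lam w ρ f (r +ᵥ s)
      = weightedAverage lam w (fun t => ρ (t - r)) f s := by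
  have hws : Measurable fun p : S × G => w p.2 p.1 := hw.measurable.comp measurable_swap
  have key : ∀ᵐ s ∂μ, ∀ᵐ t ∂lam, w r s * w t (r +ᵥ s) = w (t + r) s := by
    rw [ae_ae_comm]
    · refine Eventually.of_forall fun t => ?_
      simpa only [add_comm r t] using hw.cocycle r t
    · refine measurableSet_eq_fun (((hw.measurable_apply r).comp measurable_fst).mul
        (hws.comp (((measurable_const_vadd r).comp measurable_fst).prodMk measurable_snd))) ?_
      exact hws.comp (measurable_fst.prodMk (measurable_snd.add_const r))
  filter_upwards [key] with s hs
  simp only [weightedAverage]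
  rw [← integral_add_right_eq_self (μ := lam) (fun t => ρ (t - r) * (w t s * f (t +ᵥ s))) r,
    ← integral_const_mul]
  refine integral_congr_ae ?_
  filter_upwards [hs] with t ht
  rw [← ht, add_sub_cancel_right, vadd_vadd]
  ring

theorem translateL1_averageL1 (r : G) (hρ : Integrable ρ lam)
    (hρr : Integrable (fun t => ρ (t - r)) lam) (F : Lp ℝ 1 μ) :
    hw.translateL1 r (hw.averageL1 hρ F) = hw.averageL1 hρr F := by
  refine Lp.ext ?_
  filter_upwards [hw.coeFn_translateL1 r (hw.averageL1 hρ F), hw.coeFn_averageL1 hρr F,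
    hw.ae_vadd (hw.coeFn_averageL1 hρ F) r,
    hw.average_shift (ρ := ρ) (lam := lam) r F]
    with s h1 h2 h3 h4
  rw [h1, h2, h3, h4]

theorem averageL1_translateL1 (r : G) (hρ : Integrable ρ lam)
    (hρr : Integrable (fun t => ρ (t - r)) lam) (F : Lp ℝ 1 μ) :
    hw.averageL1 hρ (hw.translateL1 r F) = hw.averageL1 hρr F := by
  have hws : Measurable fun p : S × G => w p.2 p.1 := hw.measurable.comp measurable_swap
  have key : ∀ᵐ s ∂μ, ∀ᵐ t ∂lam, w t s * w r (t +ᵥ s) = w (t + r) s := by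
    rw [ae_ae_comm]
    · exact Eventually.of_forall fun t => hw.cocycle t r
    · refine measurableSet_eq_fun (hws.mul ((hw.measurable_apply r).comp
        (measurable_snd.vadd measurable_fst))) ?_
      exact hws.comp (measurable_fst.prodMk (measurable_snd.add_const r))
  refine Lp.ext ?_
  filter_upwards [hw.coeFn_averageL1 hρ (hw.translateL1 r F), hw.coeFn_averageL1 hρr F,
    hw.ae_ae_vadd (hw.coeFn_translateL1 r F) lam, key] with s h1 h2 h3 h4
  rw [h1, h2]
  simp only [weightedAverage]
  rw [← integral_add_right_eq_self (μ := lam) (fun t => ρ (t - r) * (w t s * F (t +ᵥ s))) r]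
  refine integral_congr_ae ?_
  filter_upwards [h3, h4] with t h5 h6
  rw [h5, ← h6, add_sub_cancel_right, vadd_vadd, add_comm t r]
  ring

end Average
end IsDensityCocycle

/-! ### Convergence sets of bounded operator families -/

section Functional

variable {E F : Type*} [NormedAddCommGroup E] [NormedSpace ℝ E] [NormedAddCommGroup F]
  [NormedSpace ℝ F]

/-- The vectors along which a family of operators converges. -/
def convergenceSubmodule (A : ℝ → E →L[ℝ] F) : Submodule ℝ E where
  carrier := {x | ∃ y, Tendsto (fun T => A T x) atTop (𝓝 y)}
  add_mem' := by
    rintro x x' ⟨y, hy⟩ ⟨y', hy'⟩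
    exact ⟨y + y', by simpa using hy.add hy'⟩
  zero_mem' := ⟨0, by simp⟩
  smul_mem' := by
    rintro a x ⟨y, hy⟩
    exact ⟨a • y, by simpa using hy.const_smul a⟩

theorem isClosed_convergenceSubmodule [CompleteSpace F] {A : ℝ → E →L[ℝ] F} {C : ℝ}
    (hA : ∀ᶠ T in atTop, ∀ x, ‖A T x‖ ≤ C * ‖x‖) :
    IsClosed (convergenceSubmodule A : Set E) := by
  refine isClosed_of_closure_subset fun x hx => ?_
  change ∃ y, Tendsto (fun T => A T x) atTop (𝓝 y)
  rw [← cauchy_map_iff_exists_tendsto, Metric.cauchy_iff]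
  refine ⟨inferInstance, fun ε hε => ?_⟩
  -- The +1 keeps the divisor positive whatever C is; the limit y along x' serves as the centre of
  -- the Cauchy estimate for x.
  obtain ⟨x', ⟨y, hy⟩, hxx'⟩ := Metric.mem_closure_iff.1 hx (ε / (4 * (|C| + 1))) (by positivity)
  have hbd : |C| * ‖x - x'‖ < ε / 4 := by
    rw [dist_eq_norm, lt_div_iff₀ (by positivity)] at hxx'
    nlinarith [norm_nonneg (x - x'), abs_nonneg C]
  refine ⟨_, image_mem_map ((hA.and (Metric.tendsto_nhds.1 hy (ε / 4) (by positivity)))), ?_⟩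
  have key : ∀ T, (∀ x, ‖A T x‖ ≤ C * ‖x‖) → dist (A T x') y < ε / 4 →
      dist (A T x) y < ε / 2 := by
    intro T h1 h2
    have h3 : dist (A T x) (A T x') < ε / 4 := by
      rw [dist_eq_norm, ← map_sub]
      refine lt_of_le_of_lt ((h1 _).trans ?_) hbd
      exact mul_le_mul_of_nonneg_right (le_abs_self C) (norm_nonneg _)
    linarith [dist_triangle (A T x) (A T x') y]
  rintro _ ⟨T, ⟨hT, hT'⟩, rfl⟩ _ ⟨T₂, ⟨hT₂, hT₂'⟩, rfl⟩
  have := dist_triangle_right (A T x) (A T₂ x) y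
  linarith [key T hT hT', key T₂ hT₂ hT₂']

end Functional

/-! ### Coboundaries and invariant vectors in Hilbert space -/

section Hilbert

variable {G H : Type*} [NormedAddCommGroup H] [InnerProductSpace ℝ H]

/-- The closed span of the coboundaries `V r y - y`. -/
def coboundaryClosure (V : G → H →L[ℝ] H) : Submodule ℝ H :=
  (Submodule.span ℝ {x | ∃ r y, x = V r y - y}).topologicalClosure

theorem coboundaryClosure_le {V : G → H →L[ℝ] H} {M : Submodule ℝ H} (hM : IsClosed (M : Set H))
    (h : ∀ r y, V r y - y ∈ M) : coboundaryClosure V ≤ M := by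
  refine Submodule.topologicalClosure_minimal _ (Submodule.span_le.2 ?_) hM
  rintro _ ⟨r, y, rfl⟩
  exact h r y

/-- If x ⟂ V_r x − x, then ‖V_r x − x‖² = 2(‖x‖² − ⟨V_r x, x⟩) = 0. Conversely, for invariant x, ⟨x,
V_r y⟩ = ⟨V_r x, V_r y⟩ = ⟨x, y⟩. -/
theorem mem_orthogonal_coboundaryClosure {V : G → H →L[ℝ] H}
    (hV : ∀ r x y, inner ℝ (V r x) (V r y) = inner ℝ x y) {x : H} :
    x ∈ (coboundaryClosure V)ᗮ ↔ ∀ r, V r x = x := by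
  constructor
  · intro hx r
    have h1 : inner ℝ (V r x - x) x = 0 := by
      refine (Submodule.mem_orthogonal _ _).1 hx _ (subset_closure (Submodule.subset_span ?_))
      exact ⟨r, x, rfl⟩
    rw [← sub_eq_zero, ← inner_self_eq_zero (𝕜 := ℝ)]
    rw [inner_sub_left] at h1
    rw [inner_sub_left, inner_sub_right, inner_sub_right, hV, real_inner_comm (V r x) x]
    linarith
  · intro hx
    have : coboundaryClosure V ≤ (ℝ ∙ x)ᗮ := by
      refine coboundaryClosure_le (Submodule.isClosed_orthogonal _) fun r y => ?_
      rw [Submodule.mem_orthogonal_singleton_iff_inner_right, inner_sub_right]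
      nth_rw 1 [← hx r]
      rw [hV, sub_self]
    rw [Submodule.mem_orthogonal]
    intro k hk
    rw [real_inner_comm]
    exact Submodule.mem_orthogonal_singleton_iff_inner_right.1 (this hk)

/-- On a coboundary, ⟨h, V_r y − y⟩ = −⟨V_r h − h, V_r y⟩, which tends to 0 by asymptotic
invariance; boundedness of h extends this to the closed span. -/
theorem tendsto_inner_of_mem_coboundaryClosure {V : G → H →L[ℝ] H}
    (hV : ∀ r x y, inner ℝ (V r x) (V r y) = inner ℝ x y) {h : ℝ → H} {C : ℝ}
    (hC : ∀ᶠ T in atTop, ‖h T‖ ≤ C)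
    (hinv : ∀ r, Tendsto (fun T => ‖V r (h T) - h T‖) atTop (𝓝 0)) {x : H}
    (hx : x ∈ coboundaryClosure V) : Tendsto (fun T => inner ℝ (h T) x) atTop (𝓝 0) := by
  let M : Submodule ℝ H :=
    { carrier := {x | Tendsto (fun T => inner ℝ (h T) x) atTop (𝓝 0)}
      add_mem' := fun {x y} hx hy => by
        have hx' : Tendsto (fun T => inner ℝ (h T) x) atTop (𝓝 0) := hx
        simpa [inner_add_right] using hx'.add hy
      zero_mem' := by simp
      smul_mem' := fun a x hx => by
        have hx' : Tendsto (fun T => inner ℝ (h T) x) atTop (𝓝 0) := hx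
        simpa [inner_smul_right] using hx'.const_mul a }
  have hM : IsClosed (M : Set H) := by
    refine isClosed_of_closure_subset fun x hx => ?_
    change Tendsto (fun T => inner ℝ (h T) x) atTop (𝓝 0)
    rw [Metric.tendsto_nhds]
    intro ε hε
    obtain ⟨x', hx', hxx'⟩ := Metric.mem_closure_iff.1 hx (ε / (2 * (|C| + 1))) (by positivity)
    have hx' : Tendsto (fun T => inner ℝ (h T) x') atTop (𝓝 0) := hx'
    filter_upwards [hC, Metric.tendsto_nhds.1 hx' (ε / 2) (by positivity)] with T h1 h2
    rw [dist_zero_right, Real.norm_eq_abs] at h2 ⊢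
    have h3 : inner ℝ (h T) x = inner ℝ (h T) x' + inner ℝ (h T) (x - x') := by
      rw [← inner_add_right, add_sub_cancel]
    have h4 : |inner ℝ (h T) (x - x')| ≤ ‖h T‖ * ‖x - x'‖ := abs_real_inner_le_norm _ _
    rw [dist_eq_norm, lt_div_iff₀ (by positivity)] at hxx'
    have h5 : ‖h T‖ * ‖x - x'‖ < ε / 2 := by
      have h6 : ‖h T‖ * ‖x - x'‖ ≤ |C| * ‖x - x'‖ :=
        mul_le_mul_of_nonneg_right (h1.trans (le_abs_self C)) (norm_nonneg _)
      nlinarith [norm_nonneg (x - x')]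
    rw [h3]
    linarith [abs_add_le (inner ℝ (h T) x') (inner ℝ (h T) (x - x'))]
  refine coboundaryClosure_le hM (fun r y => ?_) hx
  change Tendsto (fun T => inner ℝ (h T) (V r y - y)) atTop (𝓝 0)
  refine squeeze_zero_norm (a := fun T => ‖V r (h T) - h T‖ * ‖V r y‖) (fun T => ?_) ?_
  · have : inner ℝ (h T) (V r y - y) = - inner ℝ (V r (h T) - h T) (V r y) := by
      rw [inner_sub_right, inner_sub_left, hV]
      ring
    rw [this, norm_neg]
    exact norm_inner_le_norm _ _
  · simpa using (hinv r).mul_const ‖V r y‖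

end Hilbert

/-! ### Square roots, products and weighted integrals -/

theorem MeasureTheory.Lp.norm_two_sq_eq_integral {S : Type*} [MeasurableSpace S] {μ : Measure S}
    (F : Lp ℝ 2 μ) : ‖F‖ ^ 2 = ∫ s, F s ^ 2 ∂μ := by
  rw [← real_inner_self_eq_norm_sq, L2.inner_def]
  simp [pow_two]

theorem sq_sqrt_sub_sqrt_le {a b : ℝ} : (√|a| - √|b|) ^ 2 ≤ |a - b| := by
  have ha := Real.sq_sqrt (abs_nonneg a)
  have hb := Real.sq_sqrt (abs_nonneg b)
  have h1 := Real.sqrt_nonneg |a|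
  have h2 := Real.sqrt_nonneg |b|
  have h3 := abs_sub_abs_le_abs_sub a b
  have h4 := abs_sub_abs_le_abs_sub b a
  rw [abs_sub_comm b a] at h4
  rcases le_total (√|a|) (√|b|) with h | h <;> nlinarith

/-- Where v ≥ δ, Markov's inequality applies; the rest of B, where v < δ, is small for small δ
because v > 0 and μ B < ∞. -/
theorem MeasureTheory.tendsto_measure_inter_of_tendsto_integral_mul {S : Type*}
    [MeasurableSpace S] {μ : Measure S} {v : S → ℝ} (hv : Measurable v) (hv0 : ∀ s, 0 < v s)
    {h : ℝ → S → ℝ} (h0 : ∀ T s, 0 ≤ h T s) (hint : ∀ T, Integrable (fun s => h T s * v s) μ)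
    (hlim : Tendsto (fun T => ∫ s, h T s * v s ∂μ) atTop (𝓝 0)) {B : Set S} (hB : MeasurableSet B)
    (hμB : μ B < ⊤) {η : ℝ} (hη : 0 < η) :
    Tendsto (fun T => μ ({s | η ≤ h T s} ∩ B)) atTop (𝓝 0) := by
  rw [ENNReal.tendsto_nhds_zero]
  intro ε hε
  have hsmall : Tendsto (fun n : ℕ => μ ({s | v s < 1 / ((n : ℝ) + 1)} ∩ B)) atTop (𝓝 0) := by
    have h1 : (⋂ n : ℕ, ({s | v s < 1 / ((n : ℝ) + 1)} ∩ B)) = ∅ := by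
      refine Set.eq_empty_of_forall_notMem fun s hs => ?_
      rw [Set.mem_iInter] at hs
      obtain ⟨n, hn⟩ := exists_nat_one_div_lt (hv0 s)
      exact absurd (hs n).1 (not_lt.2 hn.le)
    rw [← measure_empty (μ := μ), ← h1]
    refine tendsto_measure_iInter_atTop
      (fun n => ((hv measurableSet_Iio).inter hB).nullMeasurableSet) ?_
      ⟨0, (lt_of_le_of_lt (measure_mono Set.inter_subset_right) hμB).ne⟩
    intro m n hmn s hs
    have h2 : v s < 1 / ((n : ℝ) + 1) := hs.1
    exact ⟨h2.trans_le (Nat.one_div_le_one_div hmn), hs.2⟩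
  obtain ⟨n, hn⟩ := ((ENNReal.tendsto_nhds_zero.1 hsmall) (ε / 2) (ENNReal.half_pos hε.ne')).exists
  set δ : ℝ := 1 / ((n : ℝ) + 1) with hδ
  have hδ0 : 0 < δ := Nat.one_div_pos_of_nat
  have hmarkov : ∀ T, μ {s | η * δ ≤ h T s * v s}
      ≤ ENNReal.ofReal (∫ s, h T s * v s ∂μ) / ENNReal.ofReal (η * δ) := by
    intro T
    have hnn : ∀ s, 0 ≤ h T s * v s := fun s => mul_nonneg (h0 T s) (hv0 s).le
    rw [ofReal_integral_eq_lintegral_ofReal (hint T) (Eventually.of_forall hnn)]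
    refine le_trans (measure_mono ?_) (meas_ge_le_lintegral_div (hint T).1.aemeasurable.ennreal_ofReal
      (by simpa using mul_pos hη hδ0) ENNReal.ofReal_ne_top)
    intro s hs
    exact ENNReal.ofReal_le_ofReal hs
  have hlim' : Tendsto (fun T => ENNReal.ofReal (∫ s, h T s * v s ∂μ) / ENNReal.ofReal (η * δ))
      atTop (𝓝 0) := by
    have h1 := ENNReal.tendsto_ofReal hlim
    rw [ENNReal.ofReal_zero] at h1
    have h2 := ENNReal.Tendsto.div_const h1 (b := ENNReal.ofReal (η * δ))
      (Or.inr (by simpa using mul_pos hη hδ0))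
    simpa using h2
  filter_upwards [ENNReal.tendsto_nhds_zero.1 hlim' (ε / 2) (ENNReal.half_pos hε.ne')] with T hT
  calc μ ({s | η ≤ h T s} ∩ B)
      ≤ μ (({s | v s < δ} ∩ B) ∪ {s | η * δ ≤ h T s * v s}) := by
        refine measure_mono fun s hs => ?_
        rcases lt_or_ge (v s) δ with h1 | h1
        · exact Or.inl ⟨h1, hs.2⟩
        · exact Or.inr (mul_le_mul hs.1 h1 hδ0.le (h0 T s))
    _ ≤ ε / 2 + ε / 2 := (measure_union_le _ _).trans (add_le_add hn ((hmarkov T).trans hT))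
    _ = ε := ENNReal.add_halves ε

/-- Multiplication by a fixed `L²` function, from `L²` to `L¹`. -/
noncomputable def mulL2 {S : Type*} [MeasurableSpace S] {μ : Measure S}
    (u : Lp ℝ 2 μ) : Lp ℝ 2 μ →L[ℝ] Lp ℝ 1 μ :=
  ((ContinuousLinearMap.mul ℝ ℝ).holderL μ 2 2 1).flip u

theorem coeFn_mulL2 {S : Type*} [MeasurableSpace S] {μ : Measure S} (u g : Lp ℝ 2 μ) :
    mulL2 u g =ᵐ[μ] fun s => g s * u s :=
  (ContinuousLinearMap.mul ℝ ℝ).coeFn_holder g u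

instance coboundaryClosure.completeSpace {G H : Type*} [NormedAddCommGroup H]
    [InnerProductSpace ℝ H] [CompleteSpace H] (V : G → H →L[ℝ] H) :
    CompleteSpace (coboundaryClosure V) :=
  (Submodule.isClosed_topologicalClosure _).completeSpace_coe

/-- The square root of the modulus of an `L¹` function, as an element of `L²`. -/
theorem MeasureTheory.Lp.memLp_sqrt_abs {S : Type*} [MeasurableSpace S] {μ : Measure S}
    (F : Lp ℝ 1 μ) : MemLp (fun s => √|F s|) 2 μ := by
  rw [memLp_two_iff_integrable_sq
    (Lp.stronglyMeasurable F).measurable.abs.sqrt.aestronglyMeasurable]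
  simpa only [Real.sq_sqrt (abs_nonneg _)] using (L1.integrable_coeFn F).abs

theorem MeasureTheory.Lp.norm_sqrt_abs_sq {S : Type*} [MeasurableSpace S] {μ : Measure S}
    (F : Lp ℝ 1 μ) :
    ‖(Lp.memLp_sqrt_abs F).toLp‖ ^ 2 = ‖F‖ := by
  rw [Lp.norm_two_sq_eq_integral, L1.norm_eq_integral_norm]
  refine integral_congr_ae ?_
  filter_upwards [(Lp.memLp_sqrt_abs F).coeFn_toLp] with s hs
  rw [hs, Real.sq_sqrt (abs_nonneg _), Real.norm_eq_abs]

theorem MeasureTheory.exists_pos_memLp_two {S : Type*} [MeasurableSpace S]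
    (μ : Measure S) [SigmaFinite μ] :
    ∃ v : S → ℝ, Measurable v ∧ (∀ s, 0 < v s) ∧ MemLp v 2 μ := by
  obtain ⟨g, hg0, hgm, hg⟩ := exists_pos_lintegral_lt_of_sigmaFinite μ one_ne_zero
  refine ⟨fun s => √(g s), hgm.coe_nnreal_real.sqrt, fun s => Real.sqrt_pos.2 (hg0 s), ?_⟩
  rw [memLp_two_iff_integrable_sq hgm.coe_nnreal_real.sqrt.aestronglyMeasurable]
  simp only [Real.sq_sqrt (NNReal.coe_nonneg _)]
  refine ⟨hgm.coe_nnreal_real.aestronglyMeasurable, ?_⟩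
  rw [hasFiniteIntegral_iff_enorm]
  simpa using hg.trans ENNReal.one_lt_top

/-! ### The ergodic theorem along Følner kernels -/

/-- Integrable weights on a group that are asymptotically normalized and invariant. -/
structure IsFolnerKernel {G : Type*} [AddCommGroup G] [MeasurableSpace G] (lam : Measure G)
    (ρ : ℝ → G → ℝ) : Prop where
  nonneg : ∀ᶠ T in atTop, ∀ t, 0 ≤ ρ T t
  integrable : ∀ T, Integrable (ρ T) lam
  tendsto_integral : Tendsto (fun T => ∫ t, ρ T t ∂lam) atTop (𝓝 1)
  tendsto_shift : ∀ r, Tendsto (fun T => ∫ t, ‖ρ T (t - r) - ρ T t‖ ∂lam) atTop (𝓝 0)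

namespace IsDensityCocycle

set_option linter.unusedSectionVars false

variable {G S : Type*} [AddCommGroup G] [MeasurableSpace G] [AddAction G S]
  [MeasurableSpace S] [MeasurableVAdd₂ G S] {μ : Measure S} [SigmaFinite μ] {w : G → S → ℝ}
  [MeasurableAdd₂ G] {lam : Measure G} [SFinite lam] [lam.IsAddLeftInvariant]
  {ρ : ℝ → G → ℝ}

section

variable (hw : IsDensityCocycle μ w) (hρ : IsFolnerKernel lam ρ)
include hw hρ

theorem eventually_norm_averageL1_le :
    ∀ᶠ T in atTop, ∀ F, ‖hw.averageL1 (hρ.integrable T) F‖ ≤ 2 * ‖F‖ := by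
  filter_upwards [hρ.nonneg, hρ.tendsto_integral.eventually_le_const one_lt_two] with T h0 h2 F
  refine (hw.norm_averageL1_le _ F).trans (mul_le_mul_of_nonneg_right ?_ (norm_nonneg F))
  simpa only [Real.norm_of_nonneg (h0 _)] using h2

theorem tendsto_averageL1_shift (r : G) (F : Lp ℝ 1 μ) :
    Tendsto (fun T => hw.averageL1
      (((hρ.integrable T).comp_sub_right r).sub (hρ.integrable T)) F) atTop (𝓝 0) := by
  refine squeeze_zero_norm (fun T => hw.norm_averageL1_le _ F) ?_
  simpa using (hρ.tendsto_shift r).mul_const ‖F‖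

theorem tendsto_translateL1_averageL1_sub (r : G) (F : Lp ℝ 1 μ) :
    Tendsto (fun T => hw.translateL1 r (hw.averageL1 (hρ.integrable T) F)
      - hw.averageL1 (hρ.integrable T) F) atTop (𝓝 0) := by
  refine (hw.tendsto_averageL1_shift hρ r F).congr fun T => ?_
  rw [hw.translateL1_averageL1 r (hρ.integrable T) ((hρ.integrable T).comp_sub_right r),
    averageL1_sub]

theorem tendsto_averageL1_coboundary (r : G) (F : Lp ℝ 1 μ) :
    Tendsto (fun T => hw.averageL1 (hρ.integrable T) (hw.translateL1 r F - F)) atTop (𝓝 0) := by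
  refine (hw.tendsto_averageL1_shift hρ r F).congr fun T => ?_
  rw [map_sub, hw.averageL1_translateL1 r (hρ.integrable T) ((hρ.integrable T).comp_sub_right r),
    averageL1_sub]

theorem translateL1_eq_of_tendsto {F F' : Lp ℝ 1 μ}
    (h : Tendsto (fun T => hw.averageL1 (hρ.integrable T) F) atTop (𝓝 F')) (r : G) :
    hw.translateL1 r F' = F' := by
  have h1 := (((hw.translateL1 r).continuous.tendsto F').comp h).sub h
  exact sub_eq_zero.1 (tendsto_nhds_unique h1 (hw.tendsto_translateL1_averageL1_sub hρ r F))

theorem tendsto_averageL1_of_invariant {F : Lp ℝ 1 μ} (hF : ∀ r, hw.translateL1 r F = F) :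
    Tendsto (fun T => hw.averageL1 (hρ.integrable T) F) atTop (𝓝 F) := by
  simp only [hw.averageL1_of_invariant _ hF]
  simpa using hρ.tendsto_integral.smul_const F

end

section

variable (hw : IsDensityCocycle μ w)
include hw

theorem translateL1_mulL2 (r : G) (u g : Lp ℝ 2 μ) :
    hw.translateL1 r (mulL2 u g) = mulL2 (hw.translateL2 r u) (hw.translateL2 r g) := by
  refine Lp.ext ?_
  filter_upwards [hw.coeFn_translateL1 r (mulL2 u g), hw.ae_vadd (coeFn_mulL2 u g) r,
    coeFn_mulL2 (hw.translateL2 r u) (hw.translateL2 r g), hw.coeFn_translateL2 r u,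
    hw.coeFn_translateL2 r g] with s h1 h2 h3 h4 h5
  rw [h1, h2, h3, h4, h5]
  nth_rw 1 [← Real.mul_self_sqrt (hw.nonneg r s)]
  ring

theorem translateL2_mem_orthogonal_iff {x : Lp ℝ 2 μ} :
    x ∈ (coboundaryClosure hw.translateL2)ᗮ ↔ ∀ r, hw.translateL2 r x = x :=
  mem_orthogonal_coboundaryClosure hw.inner_translateL2

/-- Invariance of u gives u·(V_r y − y) = U_r(uy) − uy, whose averages tend to 0, and makes ug
invariant when g is; the orthogonal splitting of L² covers every g. -/
theorem mulL2_mem_convergenceSubmodule (hρ : IsFolnerKernel lam ρ) {u : Lp ℝ 2 μ}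
    (hu : ∀ r, hw.translateL2 r u = u) (g : Lp ℝ 2 μ) :
    mulL2 u g ∈ convergenceSubmodule fun T => hw.averageL1 (hρ.integrable T) := by
  set C := convergenceSubmodule fun T => hw.averageL1 (hρ.integrable T) with hC
  have hclosed : IsClosed (C : Set (Lp ℝ 1 μ)) :=
    isClosed_convergenceSubmodule (hw.eventually_norm_averageL1_le hρ)
  let M : Submodule ℝ (Lp ℝ 2 μ) := C.comap (mulL2 u).toLinearMap
  have hM : IsClosed (M : Set (Lp ℝ 2 μ)) := hclosed.preimage (mulL2 u).continuous
  have h1 : coboundaryClosure hw.translateL2 ≤ M := by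
    refine coboundaryClosure_le hM fun r y => ?_
    change mulL2 u (hw.translateL2 r y - y) ∈ C
    have h2 : mulL2 u (hw.translateL2 r y) = hw.translateL1 r (mulL2 u y) := by
      rw [hw.translateL1_mulL2, hu]
    rw [map_sub, h2]
    exact ⟨0, hw.tendsto_averageL1_coboundary hρ r _⟩
  have h2 : (coboundaryClosure hw.translateL2)ᗮ ≤ M := by
    intro x hx
    rw [hw.translateL2_mem_orthogonal_iff] at hx
    change mulL2 u x ∈ C
    refine ⟨mulL2 u x, hw.tendsto_averageL1_of_invariant hρ fun r => ?_⟩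
    rw [hw.translateL1_mulL2, hu, hx]
  have h3 : M = ⊤ := by
    rw [eq_top_iff, ← Submodule.sup_orthogonal_of_hasOrthogonalProjection
      (K := coboundaryClosure hw.translateL2)]
    exact sup_le h1 h2
  have : g ∈ M := h3 ▸ Submodule.mem_top
  exact this

theorem mem_convergenceSubmodule_of_support (hρ : IsFolnerKernel lam ρ) {u : Lp ℝ 2 μ}
    (hu : ∀ r, hw.translateL2 r u = u) {F : Lp ℝ 1 μ} (hF : ∀ᵐ s ∂μ, u s = 0 → F s = 0) :
    F ∈ convergenceSubmodule fun T => hw.averageL1 (hρ.integrable T) := by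
  have hclosed : IsClosed ((convergenceSubmodule fun T => hw.averageL1 (hρ.integrable T) :
      Submodule ℝ (Lp ℝ 1 μ)) : Set (Lp ℝ 1 μ)) :=
    isClosed_convergenceSubmodule (hw.eventually_norm_averageL1_le hρ)
  have hum := (Lp.stronglyMeasurable u).measurable
  have hFm := (Lp.stronglyMeasurable F).measurable
  -- On this set |F/u| ≤ n|u|, so the truncated quotient is in L²; the sets exhaust {u ≠ 0}, and F
  -- vanishes elsewhere.
  let A : ℕ → Set S := fun n => {s | |F s| ≤ n * u s ^ 2}
  have hA : ∀ n, MeasurableSet (A n) := fun n =>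
    measurableSet_le hFm.abs ((hum.pow_const 2).const_mul _)
  let g : ℕ → S → ℝ := fun n => (A n).indicator fun s => F s / u s
  have hgm : ∀ n, Measurable (g n) := fun n => (hFm.div hum).indicator (hA n)
  have hg : ∀ n, MemLp (g n) 2 μ := by
    intro n
    refine MemLp.of_le_mul (c := n) (Lp.memLp u) (hgm n).aestronglyMeasurable
      (Eventually.of_forall fun s => ?_)
    by_cases hs : s ∈ A n
    · simp only [g, Set.indicator_of_mem hs, norm_div, Real.norm_eq_abs]
      refine div_le_of_le_mul₀ (abs_nonneg _) (by positivity) ?_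
      rw [mul_assoc, ← pow_two, sq_abs]
      exact hs
    · simp only [g, Set.indicator_of_notMem hs, norm_zero]
      positivity
  have hcoe : ∀ n, mulL2 u ((hg n).toLp) =ᵐ[μ] (A n).indicator F := by
    intro n
    filter_upwards [coeFn_mulL2 u (hg n).toLp, (hg n).coeFn_toLp, hF] with s h1 h2 h3
    rw [h1, h2]
    by_cases hs : s ∈ A n
    · simp only [g, Set.indicator_of_mem hs]
      by_cases h0 : u s = 0
      · rw [h0, h3 h0, mul_zero]
      · exact div_mul_cancel₀ _ h0
    · simp only [g, Set.indicator_of_notMem hs, zero_mul]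
  refine hclosed.mem_of_tendsto (f := fun n => mulL2 u ((hg n).toLp)) (b := atTop) ?_
    (Eventually.of_forall fun n => hw.mulL2_mem_convergenceSubmodule hρ hu _)
  rw [Lp.tendsto_Lp_iff_tendsto_eLpNorm']
  have hdom := tendsto_lintegral_norm_of_dominated_convergence (μ := μ)
    (F := fun n => (A n).indicator F) (f := F) (bound := fun s => ‖F s‖)
    (fun n => (hFm.indicator (hA n)).aestronglyMeasurable)
    (L1.integrable_coeFn F).norm.2
    (fun n => Eventually.of_forall fun s => norm_indicator_le_norm_self _ _) (by
      filter_upwards [hF] with s hs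
      refine tendsto_const_nhds.congr' ?_
      by_cases h0 : u s = 0
      · refine Eventually.of_forall fun n => ?_
        simp [Set.indicator_apply, hs h0]
      · filter_upwards [eventually_ge_atTop ⌈|F s| / u s ^ 2⌉₊] with n hn
        rw [Set.indicator_of_mem]
        change |F s| ≤ n * u s ^ 2
        rw [← div_le_iff₀ (by positivity)]
        exact (Nat.le_ceil _).trans (by exact_mod_cast hn))
  refine hdom.congr fun n => ?_
  rw [eLpNorm_one_eq_lintegral_enorm]
  refine lintegral_congr_ae ?_
  filter_upwards [hcoe n] with s hs
  rw [Pi.sub_apply, hs, ofReal_norm]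

/-- Invariance reads √w_r · u∘φ_r = u, and w_r > 0 almost everywhere. -/
theorem ae_vadd_eq_zero_iff {u : Lp ℝ 2 μ} (hu : ∀ r, hw.translateL2 r u = u) (r : G) :
    ∀ᵐ s ∂μ, (u (r +ᵥ s) = 0 ↔ u s = 0) := by
  have h := hw.coeFn_translateL2 r u
  rw [hu r] at h
  filter_upwards [h, hw.pos_ae r] with s h1 h2
  rw [h1, mul_eq_zero, Real.sqrt_eq_zero']
  simp [h2]

theorem ae_ae_vadd_eq_zero_iff {u : Lp ℝ 2 μ} (hu : ∀ r, hw.translateL2 r u = u)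
    (lam : Measure G) [SFinite lam] :
    ∀ᵐ s ∂μ, ∀ᵐ t ∂lam, (u (t +ᵥ s) = 0 ↔ u s = 0) := by
  have hum := (Lp.stronglyMeasurable u).measurable
  rw [ae_ae_comm]
  · exact Eventually.of_forall fun t => hw.ae_vadd_eq_zero_iff hu t
  · have h1 : MeasurableSet {p : S × G | u (p.2 +ᵥ p.1) = 0} :=
      (hum.comp (measurable_snd.vadd measurable_fst)) (measurableSet_singleton 0)
    have h2 : MeasurableSet {p : S × G | u p.1 = 0} :=
      (hum.comp measurable_fst) (measurableSet_singleton 0)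
    exact (h1.mem.iff h2.mem).setOf

/-- For every `v` in `L²` there is an invariant `u` such that `v` restricted to the
zero set of `u` lies in the closed span of the coboundaries. -/
theorem exists_invariant_indicator_mem (v : Lp ℝ 2 μ) :
    ∃ u : Lp ℝ 2 μ, (∀ r, hw.translateL2 r u = u) ∧
      ∀ x : Lp ℝ 2 μ, x =ᵐ[μ] {s | u s = 0}.indicator v →
        x ∈ coboundaryClosure hw.translateL2 := by
  obtain ⟨k, hk, u, hu, rfl⟩ :=
    (coboundaryClosure hw.translateL2).exists_add_mem_mem_orthogonal v
  rw [hw.translateL2_mem_orthogonal_iff] at hu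
  refine ⟨u, hu, fun x hx => ?_⟩
  have hN : MeasurableSet {s | u s = 0} :=
    (Lp.stronglyMeasurable u).measurable (measurableSet_singleton 0)
  -- It suffices to test against invariant h. With N = {u = 0}, ⟨h, 1_N v⟩ = ⟨1_N h, k + u⟩; here
  -- 1_N h is again invariant, hence orthogonal to k, and its product with u vanishes.
  rw [← Submodule.orthogonal_orthogonal (coboundaryClosure hw.translateL2),
    Submodule.mem_orthogonal]
  intro h hh
  have hh' := hw.translateL2_mem_orthogonal_iff.1 hh
  let y : Lp ℝ 2 μ := ((Lp.memLp h).indicator hN).toLp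
  have hy : y =ᵐ[μ] {s | u s = 0}.indicator h := ((Lp.memLp h).indicator hN).coeFn_toLp
  have hyinv : y ∈ (coboundaryClosure hw.translateL2)ᗮ := by
    rw [hw.translateL2_mem_orthogonal_iff]
    intro r
    have h3 := hw.coeFn_translateL2 r h
    rw [hh' r] at h3
    refine Lp.ext ?_
    filter_upwards [hy, hw.coeFn_translateL2 r y, hw.ae_vadd hy r, h3,
      hw.ae_vadd_eq_zero_iff hu r] with s h1 h2 h4 h5 h6
    rw [h2, h4, h1]
    by_cases h0 : u s = 0
    · simp [h6, h0, h5]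
    · simp [h6, h0]
  have e1 : inner ℝ h x = inner ℝ y (k + u) := by
    rw [L2.inner_def, L2.inner_def]
    refine integral_congr_ae ?_
    filter_upwards [hx, hy] with s h1 h2
    rw [h1, h2]
    by_cases h0 : u s = 0 <;> simp [h0]
  have e2 : inner ℝ y u = 0 := by
    rw [L2.inner_def]
    refine integral_eq_zero_of_ae ?_
    filter_upwards [hy] with s h2
    rw [h2]
    by_cases h0 : u s = 0 <;> simp [h0]
  rw [e1, inner_add_right, e2, add_zero, real_inner_comm]
  exact (Submodule.mem_orthogonal _ _).1 hyinv k hk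

/-- Since V_r √|F| = √|U_r F|, the pointwise bound (√|a| − √|b|)² ≤ |a − b| carries asymptotic
invariance from L¹ to L². -/
theorem norm_translateL2_sqrt_abs_sub_sq_le (r : G) (F : Lp ℝ 1 μ) :
    ‖hw.translateL2 r (Lp.memLp_sqrt_abs F).toLp - (Lp.memLp_sqrt_abs F).toLp‖ ^ 2
      ≤ ‖hw.translateL1 r F - F‖ := by
  rw [Lp.norm_two_sq_eq_integral, L1.norm_eq_integral_norm]
  refine integral_mono_ae (Lp.memLp _).integrable_sq (L1.integrable_coeFn _).norm ?_
  have h0 := (Lp.memLp_sqrt_abs F).coeFn_toLp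
  filter_upwards [Lp.coeFn_sub (hw.translateL2 r (Lp.memLp_sqrt_abs F).toLp)
    (Lp.memLp_sqrt_abs F).toLp, h0, hw.ae_vadd h0 r, Lp.coeFn_sub (hw.translateL1 r F) F,
    hw.coeFn_translateL1 r F, hw.coeFn_translateL2 r (Lp.memLp_sqrt_abs F).toLp]
    with s h1 h2 h3 h4 h5 h6
  rw [h1, h4, Pi.sub_apply, Pi.sub_apply, h5, h6, h3, h2, Real.norm_eq_abs,
    ← Real.sqrt_mul (hw.nonneg r s)]
  have : w r s * |F (r +ᵥ s)| = |w r s * F (r +ᵥ s)| := by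
    rw [abs_mul, abs_of_nonneg (hw.nonneg r s)]
  rw [this]
  exact sq_sqrt_sub_sqrt_le

theorem tendsto_inner_sqrt_abs_averageL1 (hρ : IsFolnerKernel lam ρ) (F : Lp ℝ 1 μ)
    {x : Lp ℝ 2 μ} (hx : x ∈ coboundaryClosure hw.translateL2) :
    Tendsto (fun T => inner ℝ
      (Lp.memLp_sqrt_abs (hw.averageL1 (hρ.integrable T) F)).toLp x) atTop (𝓝 0) := by
  refine tendsto_inner_of_mem_coboundaryClosure hw.inner_translateL2 (C := √(2 * ‖F‖)) ?_
    (fun r => ?_) hx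
  · filter_upwards [hw.eventually_norm_averageL1_le hρ] with T hT
    refine Real.le_sqrt_of_sq_le ?_
    rw [Lp.norm_sqrt_abs_sq]
    exact hT F
  · have h1 := ((hw.tendsto_translateL1_averageL1_sub hρ r F).norm).sqrt
    rw [norm_zero, Real.sqrt_zero] at h1
    exact squeeze_zero (fun T => norm_nonneg _)
      (fun T => Real.le_sqrt_of_sq_le (hw.norm_translateL2_sqrt_abs_sub_sq_le r _)) h1

/-- Stochastic ergodic theorem: averages along a Følner kernel converge locally in measure to an
invariant function. -/
theorem exists_convergesStochastically (hρ : IsFolnerKernel lam ρ) (F : Lp ℝ 1 μ) :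
    ∃ F' : Lp ℝ 1 μ, (∀ r, hw.translateL1 r F' = F') ∧
      ConvergesStochastically μ (fun T => weightedAverage lam w (ρ T) F) F' := by
  obtain ⟨v, hvm, hv0, hv⟩ := exists_pos_memLp_two μ
  obtain ⟨u, hu, hx⟩ := hw.exists_invariant_indicator_mem hv.toLp
  have hN : MeasurableSet {s | u s = 0} :=
    (Lp.stronglyMeasurable u).measurable (measurableSet_singleton 0)
  let x : Lp ℝ 2 μ := (hv.indicator hN).toLp
  have hxv : x =ᵐ[μ] {s | u s = 0}.indicator v := (hv.indicator hN).coeFn_toLp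
  have hxK : x ∈ coboundaryClosure hw.translateL2 := by
    refine hx x ?_
    filter_upwards [hxv, hv.coeFn_toLp] with s h1 h2
    rw [h1, Set.indicator_apply, Set.indicator_apply, h2]
  -- F − FN has norm convergent averages; those of FN tend to 0 only in measure. Each gets ε/2,
  -- which becomes √(ε/2) after the square root.
  let FN : Lp ℝ 1 μ := ((Lp.memLp F).indicator hN).toLp
  have hFN : FN =ᵐ[μ] {s | u s = 0}.indicator F := ((Lp.memLp F).indicator hN).coeFn_toLp
  have hFP : ∀ᵐ s ∂μ, u s = 0 → (F - FN) s = 0 := by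
    filter_upwards [Lp.coeFn_sub F FN, hFN] with s h1 h2 h3
    rw [h1, Pi.sub_apply, h2, Set.indicator_of_mem (by exact h3), sub_self]
  obtain ⟨F', hF'⟩ : ∃ F', Tendsto (fun T => hw.averageL1 (hρ.integrable T) (F - FN)) atTop
      (𝓝 F') := hw.mem_convergenceSubmodule_of_support hρ hu hFP
  have hinv : ∀ r, hw.translateL1 r F' = F' := fun r => hw.translateL1_eq_of_tendsto hρ hF' r
  refine ⟨F', hinv, fun ε hε B hB hμB => ?_⟩
  have hmeas := tendstoInMeasure_of_tendsto_Lp hF'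
  rw [tendstoInMeasure_iff_norm] at hmeas
  have hP := hmeas (ε / 2) (half_pos hε)
  let q : ℝ → Lp ℝ 2 μ := fun T =>
    (Lp.memLp_sqrt_abs (hw.averageL1 (hρ.integrable T) FN)).toLp
  let h : ℝ → S → ℝ := fun T =>
    {s | u s = 0}.indicator fun s => √|hw.averageL1 (hρ.integrable T) FN s|
  have hNull : Tendsto (fun T => μ ({s | √(ε / 2) ≤ h T s} ∩ B)) atTop (𝓝 0) := by
    have hae : ∀ T, (fun s => inner ℝ (q T s) (x s)) =ᵐ[μ] fun s => h T s * v s := by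
      intro T
      filter_upwards [(Lp.memLp_sqrt_abs (hw.averageL1 (hρ.integrable T) FN)).coeFn_toLp, hxv]
        with s h1 h2
      rw [h1, h2]
      by_cases h0 : u s = 0 <;> simp [h, h0, mul_comm]
    have h0 : ∀ T s, 0 ≤ h T s := fun T s =>
      Set.indicator_nonneg (fun s _ => Real.sqrt_nonneg _) s
    have hint : ∀ T, Integrable (fun s => h T s * v s) μ := fun T =>
      (L2.integrable_inner (𝕜 := ℝ) (q T) x).congr (hae T)
    have hlim : Tendsto (fun T => ∫ s, h T s * v s ∂μ) atTop (𝓝 0) := by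
      have h1 : Tendsto (fun T => inner ℝ (q T) x) atTop (𝓝 0) :=
        hw.tendsto_inner_sqrt_abs_averageL1 hρ FN hxK
      refine h1.congr fun T => ?_
      rw [L2.inner_def]
      exact integral_congr_ae (hae T)
    exact tendsto_measure_inter_of_tendsto_integral_mul hvm hv0 h0 hint hlim hB hμB
      (Real.sqrt_pos.2 (half_pos hε))
  have hsum := hP.add hNull
  rw [add_zero] at hsum
  refine tendsto_of_tendsto_of_tendsto_of_le_of_le tendsto_const_nhds hsum
    (fun T => bot_le) (fun T => ?_)
  refine le_trans (measure_mono_ae ?_) (measure_union_le _ _)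
  filter_upwards [hw.coeFn_averageL1 (hρ.integrable T) F,
    hw.coeFn_averageL1 (hρ.integrable T) FN, hw.ae_ae_vadd hFN lam,
    hw.ae_ae_vadd_eq_zero_iff hu lam,
    Lp.coeFn_sub (hw.averageL1 (hρ.integrable T) F) (hw.averageL1 (hρ.integrable T) FN)]
    with s h1 h2 h3 h4 h5
  rintro ⟨hs, hsB⟩
  have hs : ε < |weightedAverage lam w (ρ T) F s - F' s| := hs
  rw [← map_sub, Pi.sub_apply, h1] at h5
  by_cases h0 : u s = 0
  · rcases le_or_gt (ε / 2) |hw.averageL1 (hρ.integrable T) FN s| with h6 | h6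
    · refine Or.inr ⟨?_, hsB⟩
      change √(ε / 2) ≤ Set.indicator _ _ s
      rw [Set.indicator_of_mem (by exact h0)]
      exact Real.sqrt_le_sqrt h6
    · refine Or.inl ?_
      change ε / 2 ≤ ‖(hw.averageL1 (hρ.integrable T) (F - FN)) s - F' s‖
      rw [h5, Real.norm_eq_abs]
      have := abs_add_le (weightedAverage lam w (ρ T) F s
        - hw.averageL1 (hρ.integrable T) FN s - F' s) (hw.averageL1 (hρ.integrable T) FN s)
      rw [show weightedAverage lam w (ρ T) F s - hw.averageL1 (hρ.integrable T) FN s - F' s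
        + hw.averageL1 (hρ.integrable T) FN s = weightedAverage lam w (ρ T) F s - F' s by ring]
        at this
      linarith
  -- Almost every translate of a point outside N stays outside N, where FN vanishes.
  · have h7 : hw.averageL1 (hρ.integrable T) FN s = 0 := by
      rw [h2]
      refine integral_eq_zero_of_ae ?_
      filter_upwards [h3, h4] with t h8 h9
      rw [h8, Set.indicator_of_notMem (by simpa [h9] using h0)]
      simp
    refine Or.inl ?_
    change ε / 2 ≤ ‖(hw.averageL1 (hρ.integrable T) (F - FN)) s - F' s‖
    rw [h5, h7, sub_zero, Real.norm_eq_abs]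
    linarith

end

end IsDensityCocycle

/-! ### Cubes form Følner kernels -/

section Cubes

/-- Sets of asymptotic volume `(2T)^d` such that each `Q T`, translated by a fixed element,
contains `Q (T - R)` for some `R`, give a Følner kernel. -/
theorem IsFolnerKernel.of_sets {G : Type*} [AddCommGroup G] [MeasurableSpace G]
    [MeasurableAdd₂ G] {lam : Measure G} [lam.IsAddLeftInvariant] (d : ℕ) {Q : ℝ → Set G}
    (hQ : ∀ T, MeasurableSet (Q T)) (hfin : ∀ T, lam (Q T) < ⊤) (hmono : Monotone Q)
    (hlim : Tendsto (fun T : ℝ => 1 / (2 * T) ^ d * lam.real (Q T)) atTop (𝓝 1))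
    (hshift : ∀ r, ∃ R : ℝ, 0 ≤ R ∧ ∀ T t, t ∈ Q (T - R) → t - r ∈ Q T) :
    IsFolnerKernel lam fun T => (Q T).indicator fun _ => 1 / (2 * T) ^ d where
  nonneg := by
    filter_upwards [eventually_ge_atTop 0] with T hT t
    exact Set.indicator_nonneg (fun _ _ => by positivity) t
  integrable T := (integrable_indicator_iff (hQ T)).2 (integrableOn_const (hfin T).ne)
  tendsto_integral := by
    refine hlim.congr fun T => ?_
    rw [integral_indicator_const _ (hQ T), smul_eq_mul, mul_comm]
  tendsto_shift r := by
    obtain ⟨R, hR, hsub⟩ := hshift r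
    -- Passing from the normalization at T − R to that at T costs the factor (1 − R/T)^d, which
    -- tends to 1.
    have hlim' : Tendsto (fun T : ℝ => 1 / (2 * T) ^ d * lam.real (Q (T - R))) atTop (𝓝 1) := by
      have h1 : Tendsto (fun T : ℝ => T - R) atTop atTop := tendsto_atTop_add_const_right _ _ tendsto_id
      have h2 : Tendsto (fun T : ℝ => (1 - R / T) ^ d) atTop (𝓝 1) := by
        have h3 : Tendsto (fun T : ℝ => R / T) atTop (𝓝 0) := tendsto_const_nhds.div_atTop tendsto_id
        simpa using (h3.const_sub 1).pow d
      have h4 := (hlim.comp h1).mul h2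
      rw [mul_one] at h4
      refine h4.congr' ?_
      filter_upwards [eventually_gt_atTop R, eventually_gt_atTop 0] with T hT hT0
      have h5 : T - R ≠ 0 := (sub_pos.2 hT).ne'
      have h6 : 1 - R / T = (T - R) / T := by field_simp
      simp only [Function.comp, h6, div_pow, mul_pow]
      field_simp
    -- `Q (T - R)` lies both in `Q T` and in its translate by r, so |1_Q(t − r) − 1_Q(t)| ≤ 1_Q(t −
    -- r) + 1_Q(t) − 2·1_{Q(T−R)}(t).
    have key : ∀ᶠ T : ℝ in atTop,
        ∫ t, ‖(Q T).indicator (fun _ => 1 / (2 * T) ^ d) (t - r)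
          - (Q T).indicator (fun _ => 1 / (2 * T) ^ d) t‖ ∂lam
        ≤ 2 * (1 / (2 * T) ^ d * lam.real (Q T)) - 2 * (1 / (2 * T) ^ d * lam.real (Q (T - R))) := by
      filter_upwards [eventually_ge_atTop 0] with T hT
      set c : ℝ := 1 / (2 * T) ^ d with hc
      have hc0 : 0 ≤ c := by positivity
      have hi : ∀ T' : ℝ, Integrable ((Q T').indicator fun _ => c) lam := fun T' =>
        (integrable_indicator_iff (hQ T')).2 (integrableOn_const (hfin T').ne)
      have hi2 := (hi T).comp_sub_right r
      have hi3 : Integrable (fun t => (Q T).indicator (fun _ => c) (t - r)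
          + (Q T).indicator (fun _ => c) t) lam := hi2.add (hi T)
      have e : 2 * (c * lam.real (Q T)) - 2 * (c * lam.real (Q (T - R)))
          = ∫ t, ((Q T).indicator (fun _ => c) (t - r) + (Q T).indicator (fun _ => c) t
            - 2 * (Q (T - R)).indicator (fun _ => c) t) ∂lam := by
        rw [integral_sub hi3 ((hi (T - R)).const_mul 2), integral_add hi2 (hi T),
          integral_sub_right_eq_self (μ := lam) ((Q T).indicator fun _ => c) r,
          integral_const_mul, integral_indicator_const _ (hQ T),
          integral_indicator_const _ (hQ (T - R)), smul_eq_mul, smul_eq_mul]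
        ring
      rw [e]
      refine integral_mono (hi2.sub (hi T)).norm
        (hi3.sub ((hi (T - R)).const_mul 2)) fun t => ?_
      by_cases h1 : t ∈ Q (T - R)
      · have h2 := hsub T t h1
        have h3 : t ∈ Q T := hmono (sub_le_self T hR) h1
        simp only [Set.indicator_of_mem h1, Set.indicator_of_mem h2, Set.indicator_of_mem h3]
        rw [sub_self, norm_zero]
        linarith
      · simp only [Set.indicator_of_notMem h1, mul_zero, sub_zero]
        by_cases h2 : t - r ∈ Q T <;> by_cases h3 : t ∈ Q T <;>
          simp [h2, h3, abs_of_nonneg hc0, hc0]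
    refine squeeze_zero' (Eventually.of_forall fun T => integral_nonneg fun t => norm_nonneg _) key ?_
    simpa using (hlim.const_mul 2).sub (hlim'.const_mul 2)

theorem cubeReal_eq_pi (d : ℕ) (T : ℝ) :
    cubeReal d T = Set.univ.pi fun _ : Fin d => Set.Ioc (-T) T := by
  ext t; simp [cubeReal]

theorem measurableSet_cubeReal (d : ℕ) (T : ℝ) : MeasurableSet (cubeReal d T) := by
  rw [cubeReal_eq_pi]
  exact MeasurableSet.univ_pi fun _ => measurableSet_Ioc

theorem cubeInt_eq_pi (d : ℕ) (T : ℝ) :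
    cubeInt d T = ↑(Fintype.piFinset fun _ : Fin d => Finset.Ioc ⌊-T⌋ ⌊T⌋) := by
  ext t; simp [cubeInt, Int.floor_lt, Int.le_floor]

theorem cubeInt_eq_preimage (d : ℕ) (T : ℝ) :
    cubeInt d T = (fun t i => (t i : ℝ)) ⁻¹' cubeReal d T := rfl

theorem cubeReal_mono (d : ℕ) : Monotone (cubeReal d) := fun T T' h t ht i =>
  ⟨by linarith [(ht i).1], by linarith [(ht i).2]⟩

theorem cubeReal_sub_mem {d : ℕ} {T : ℝ} {r t : Fin d → ℝ} (ht : t ∈ cubeReal d (T - ‖r‖)) :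
    t - r ∈ cubeReal d T := fun i => by
  have h := abs_le.1 (norm_le_pi_norm r i)
  have h' := ht i
  simp only [Pi.sub_apply]
  constructor <;> linarith [h.1, h.2, h'.1, h'.2]

theorem isFolnerKernel_cubeReal (d : ℕ) :
    IsFolnerKernel (volume : Measure (Fin d → ℝ))
      fun T => (cubeReal d T).indicator fun _ => 1 / (2 * T) ^ d := by
  have hvol : ∀ T, volume (cubeReal d T) = ENNReal.ofReal (2 * T) ^ d := fun T => by
    rw [cubeReal_eq_pi, volume_pi_pi]
    simp [two_mul]
  refine IsFolnerKernel.of_sets d (measurableSet_cubeReal d) (fun T => ?_) (cubeReal_mono d) ?_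
    fun r => ⟨‖r‖, norm_nonneg r, fun T t ht => cubeReal_sub_mem ht⟩
  · rw [hvol]
    exact ENNReal.pow_lt_top ENNReal.ofReal_lt_top
  · refine tendsto_const_nhds.congr' ?_
    filter_upwards [eventually_gt_atTop 0] with T hT
    rw [Measure.real, hvol, ENNReal.toReal_pow, ENNReal.toReal_ofReal (by positivity)]
    field_simp

theorem isFolnerKernel_cubeInt (d : ℕ) :
    IsFolnerKernel (Measure.count : Measure (Fin d → ℤ))
      fun T => (cubeInt d T).indicator fun _ => 1 / (2 * T) ^ d := by
  refine IsFolnerKernel.of_sets d (fun T => MeasurableSet.of_discrete) (fun T => ?_)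
    (fun T T' h t ht => cubeReal_mono d h ht) ?_
    fun r => ⟨‖fun i => (r i : ℝ)‖, norm_nonneg _, fun T t ht => ?_⟩
  · rw [cubeInt_eq_pi, Measure.count_apply_finset]
    exact ENNReal.natCast_lt_top _
  -- An edge holds ⌊T⌋ − ⌊−T⌋ integers, which differs from 2T by at most 1.
  · have hcard : Tendsto (fun T : ℝ => ((⌊T⌋ - ⌊-T⌋ : ℤ) : ℝ) / (2 * T)) atTop (𝓝 1) := by
      have h1 : Tendsto (fun T : ℝ => 1 / (2 * T)) atTop (𝓝 0) :=
        tendsto_const_nhds.div_atTop (tendsto_id.const_mul_atTop two_pos)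
      refine tendsto_of_tendsto_of_tendsto_of_le_of_le' (by simpa using h1.const_sub 1)
        (by simpa using h1.const_add 1) ?_ ?_ <;>
      · filter_upwards [eventually_gt_atTop 0] with T hT
        have h2 := Int.floor_le T
        have h3 := Int.lt_floor_add_one T
        have h4 := Int.floor_le (-T)
        have h5 := Int.lt_floor_add_one (-T)
        push_cast
        field_simp
        linarith
    have h2 := hcard.pow d
    rw [one_pow] at h2
    refine h2.congr' ?_
    filter_upwards [eventually_gt_atTop 0] with T hT
    have h3 : ⌊-T⌋ ≤ ⌊T⌋ := Int.floor_mono (by linarith)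
    rw [Measure.real, cubeInt_eq_pi, Measure.count_apply_finset, ENNReal.toReal_natCast,
      Fintype.card_piFinset_const, Int.card_Ioc, div_pow, Nat.cast_pow]
    have h4 : (((⌊T⌋ - ⌊-T⌋).toNat : ℕ) : ℝ) = ((⌊T⌋ - ⌊-T⌋ : ℤ) : ℝ) := by
      rw [← Int.cast_natCast, Int.toNat_of_nonneg (by linarith)]
    rw [h4]
    ring
  · rw [cubeInt_eq_preimage] at ht ⊢
    have := cubeReal_sub_mem ht
    simpa [Set.mem_preimage, cubeReal] using this

end Cubes

/-! ### Independence of the density version, and the final theorem -/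

section StochasticErgodicTheorem

variable {G S : Type*} [AddCommGroup G] [MeasurableSpace G] [AddAction G S]
  [MeasurableSpace S] [MeasurableVAdd₂ G S] {μ : Measure S} [SigmaFinite μ]

/-- Fubini gives one null set of s that does not depend on T, so averages built from different
versions agree for all T at once. -/
theorem IsDensityVersion.ae_ae_eq {w w' : G → S → ℝ} (hφ : IsNonsingularAction G μ)
    (hw : IsDensityVersion μ w) (hw' : IsDensityVersion μ w') (lam : Measure G) [SFinite lam]
    {f f' : S → ℝ} (hf : f =ᵐ[μ] f') :
    ∀ᵐ s ∂μ, ∀ᵐ t ∂lam, w t s * f (t +ᵥ s) = |w' t s| * f' (t +ᵥ s) := by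
  have key : ∀ᵐ s ∂μ, ∀ᵐ t ∂lam, w t s = |w' t s| := by
    rw [ae_ae_comm]
    · exact Eventually.of_forall fun t => hw.ae_eq_of_version hw' t
    · exact measurableSet_eq_fun (hw.measurable.comp measurable_swap)
        (hw'.measurable.comp measurable_swap).abs
  filter_upwards [key, (hw'.isDensityCocycle_abs hφ).ae_ae_vadd hf lam] with s h1 h2
  filter_upwards [h1, h2] with t h3 h4
  rw [h3, h4]

theorem exists_integrable_convergesStochastically [StandardBorelSpace S] [MeasurableAdd₂ G]
    [MeasurableNeg G] {lam : Measure G} [SFinite lam] [lam.IsAddLeftInvariant]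
    (hφ : IsNonsingularAction G μ) {ρ : ℝ → G → ℝ} (hρ : IsFolnerKernel lam ρ) {f₀ : S → ℝ}
    (hf₀ : Integrable f₀ μ) :
    ∃ f' : S → ℝ, Integrable f' μ ∧
      (∀ w : G → S → ℝ, IsDensityVersion μ w →
        (∀ T, (∀ᵐ s ∂μ, Integrable (fun t => ρ T t * (w t s * f₀ (t +ᵥ s))) lam) ∧
          Integrable (weightedAverage lam w (ρ T) f₀) μ) ∧
        ConvergesStochastically μ (fun T => weightedAverage lam w (ρ T) f₀) f') ∧
      (∀ t : G, dualOperator μ (MeasurableEquiv.vadd t) f' =ᵐ[μ] f') := by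
  -- The limit must not depend on w, so it is built from one fixed version.
  obtain ⟨w₀, hw₀⟩ := exists_isDensityVersion (G := G) μ hφ
  have hc := hw₀.isDensityCocycle_abs hφ
  let F : Lp ℝ 1 μ := (memLp_one_iff_integrable.2 hf₀).toLp
  have hF : f₀ =ᵐ[μ] F := (memLp_one_iff_integrable.2 hf₀).coeFn_toLp.symm
  obtain ⟨F', hinv, hconv⟩ := hc.exists_convergesStochastically hρ F
  refine ⟨F', L1.integrable_coeFn F', fun w hw => ?_, fun t => ?_⟩
  · have hae := hw.ae_ae_eq hφ hw₀ lam hF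
    have havg : ∀ᵐ s ∂μ, ∀ T, weightedAverage lam w (ρ T) f₀ s
        = weightedAverage lam (fun t s => |w₀ t s|) (ρ T) F s := by
      filter_upwards [hae] with s hs T
      refine integral_congr_ae ?_
      filter_upwards [hs] with t ht
      rw [ht]
    refine ⟨fun T => ⟨?_, ?_⟩, fun ε hε B hB hμB => ?_⟩
    · filter_upwards [hae, hc.ae_integrable_average_kernel (hρ.integrable T) F] with s h1 h2
      refine h2.congr ?_
      filter_upwards [h1] with t ht
      rw [ht]
    · refine (memLp_one_iff_integrable.1 (hc.memLp_average (hρ.integrable T) F)).congr ?_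
      filter_upwards [havg] with s hs
      exact (hs T).symm
    · refine (hconv ε hε B hB hμB).congr fun T => measure_congr ?_
      filter_upwards [havg] with s hs
      refine propext (and_congr_left fun _ => ?_)
      change ε < |_ - _| ↔ ε < |_ - _|
      rw [hs T]
  -- The dual operator of φ_t is translation by −t.
  · have h1 := hc.coeFn_translateL1 (-t) F'
    rw [hinv (-t)] at h1
    filter_upwards [h1, hw₀.ae_eq (-t)] with s h2 h3
    rw [h2, h3, abs_of_nonneg ENNReal.toReal_nonneg, neg_neg]
    rfl

end StochasticErgodicTheorem

theorem weightedAverage_indicator {G S : Type*} [MeasurableSpace G] [AddCommGroup G]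
    [AddAction G S] {lam : Measure G} {Q : Set G} (hQ : MeasurableSet Q) (c : ℝ)
    (w : G → S → ℝ) (f : S → ℝ) (s : S) :
    weightedAverage lam w (Q.indicator fun _ => c) f s
      = c * ∫ t in Q, w t s * f (t +ᵥ s) ∂lam := by
  rw [← integral_const_mul, ← integral_indicator hQ]
  refine integral_congr_ae (Eventually.of_forall fun t => ?_)
  by_cases ht : t ∈ Q <;> simp [ht]

theorem mainTheorem4 {S : Type*} [MeasurableSpace S] [StandardBorelSpace S]
    (μ : Measure S) [SigmaFinite μ] (d : ℕ) (f₀ : S → ℝ) (hf₀ : Integrable f₀ μ) :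
    (∀ [AddAction (Fin d → ℤ) S] [MeasurableVAdd₂ (Fin d → ℤ) S],
      IsNonsingularAction (Fin d → ℤ) μ →
      ∃ f' : S → ℝ, Integrable f' μ ∧
        (∀ w : (Fin d → ℤ) → S → ℝ, IsDensityVersion μ w →
          (∀ T : ℝ, 0 < T → Integrable (fun s => averageInt T (fun t => w t s * f₀ (t +ᵥ s))) μ) ∧
          ConvergesStochastically μ
            (fun T s => averageInt T (fun t => w t s * f₀ (t +ᵥ s))) f') ∧
        (∀ t : Fin d → ℤ, dualOperator μ (MeasurableEquiv.vadd t) f' =ᵐ[μ] f')) ∧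
    (∀ [AddAction (Fin d → ℝ) S] [MeasurableVAdd₂ (Fin d → ℝ) S],
      IsNonsingularAction (Fin d → ℝ) μ →
      ∃ f' : S → ℝ, Integrable f' μ ∧
        (∀ w : (Fin d → ℝ) → S → ℝ, IsDensityVersion μ w →
          (∀ T : ℝ, 0 < T →
            (∀ᵐ s ∂μ, IntegrableOn (fun t => w t s * f₀ (t +ᵥ s)) (cubeReal d T)) ∧
            Integrable (fun s => averageReal T (fun t => w t s * f₀ (t +ᵥ s))) μ) ∧
          ConvergesStochastically μ
            (fun T s => averageReal T (fun t => w t s * f₀ (t +ᵥ s))) f') ∧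
        (∀ t : Fin d → ℝ, dualOperator μ (MeasurableEquiv.vadd t) f' =ᵐ[μ] f')) := by
  constructor
  · intro _ _ hφ
    obtain ⟨f', hf', hw, hinv⟩ :=
      exists_integrable_convergesStochastically hφ (isFolnerKernel_cubeInt d) hf₀
    refine ⟨f', hf', fun w hwv => ?_, hinv⟩
    have e : ∀ T, weightedAverage Measure.count w
        ((cubeInt d T).indicator fun _ => 1 / (2 * T) ^ d) f₀
        = fun s => averageInt T (fun t => w t s * f₀ (t +ᵥ s)) := fun T =>
      funext fun s => weightedAverage_indicator MeasurableSet.of_discrete _ w f₀ s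
    obtain ⟨h1, h2⟩ := hw w hwv
    simp only [e] at h1 h2
    -- The cube in ℤ^d is finite, so absolute convergence needs no separate claim.
    exact ⟨fun T _ => (h1 T).2, h2⟩
  · intro _ _ hφ
    obtain ⟨f', hf', hw, hinv⟩ :=
      exists_integrable_convergesStochastically hφ (isFolnerKernel_cubeReal d) hf₀
    refine ⟨f', hf', fun w hwv => ?_, hinv⟩
    have e : ∀ T, weightedAverage volume w
        ((cubeReal d T).indicator fun _ => 1 / (2 * T) ^ d) f₀
        = fun s => averageReal T (fun t => w t s * f₀ (t +ᵥ s)) := fun T =>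
      funext fun s => weightedAverage_indicator (measurableSet_cubeReal d T) _ w f₀ s
    obtain ⟨h1, h2⟩ := hw w hwv
    simp only [e] at h1 h2
    refine ⟨fun T hT => ⟨?_, (h1 T).2⟩, h2⟩
    filter_upwards [(h1 T).1] with s hs
    have hc : (1 / (2 * T) ^ d : ℝ) ≠ 0 := by positivity
    rw [← integrable_indicator_iff (measurableSet_cubeReal d T)]
    refine (hs.const_mul (1 / (2 * T) ^ d)⁻¹).congr (Eventually.of_forall fun t => ?_)
    by_cases ht : t ∈ cubeReal d T
    · simp only [Set.indicator_of_mem ht]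
      rw [inv_mul_cancel_left₀ hc]
    · simp [ht]
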